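/- Let $(X_{i,j})_{1\le i\le j}$ be jointly independent random variables such that the $X_{i,j}$, $i<j$, are identically distributed and complex-valued with $\mathbb{E}X_{1,2}=0$, $\mathbb{E}|X_{1,2}|^2=1$ and independent real and imaginary parts, and the $X_{i,i}$ are identically distributed and real-valued. Assume that there are $\alpha\in(0,2)$ and $a,b\in(0,\infty)$ with $$\lim_{t\to+\infty}-t^{-\alpha}\log\mathbb{P}(|X_{1,1}|>t)=b,\qquad \lim_{t\to+\infty}-t^{-\alpha}\log\mathbb{P}(|X_{1,2}|>t)=a,$$ and that there are probability measures $\upsilon_1,\upsilon_2$ on $\mathbb{S}^1$ and $t_0>0$ such that, for all $t\ge t_0$, all measurable $U\subset\mathbb{S}^1$ and both $(Y,\upsilon)=(X_{1,1},\upsilon_1)$ and $(Y,\upsilon)=(X_{1,2},\upsilon_2)$, $$\mathbb{P}\left(Y/|Y|\in U,\ |Y|\ge t\right)=\upsilon(U)\,\mathbb{P}(|Y|\ge t).$$ Let $X=X(N)$ be the $N\times N$ Hermitian matrix with entries $X_{i,j}$ for $i\le j$, let $X_N=X/\sqrt N$, and for a Hermitian matrix $Y$ let $\lambda_Y$ be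 its largest eigenvalue. Put $|z|_\infty=\max(|\Re z|,|\Im z|)$ for $z\in\mathbb{C}$. Fix $d>0$ with $d\alpha>1$. For $\varepsilon>0$, let $C^{\varepsilon}$ be the $N\times N$ matrix with entries $$C^{\varepsilon}_{i,j}=\mathbf{1}_{\varepsilon N^{1/2}\le|X_{i,j}|_\infty\le\varepsilon^{-1}N^{1/2}}\,\frac{X_{i,j}}{\sqrt N}.$$ For all $N$ large enough, let $P_N$ be the law of $X_{1,1}$ conditioned on $\{|X_{1,1}|_\infty\le(\log N)^d\}$, let $Q_N$ be the law of $X_{1,2}$ conditioned on $\{|X_{1,2}|_\infty\le(\log N)^d\}$, and let $H$ be a random $N\times N$ Hermitian matrix, independent of $X$, such that $(H_{i,j})_{1\le i\le j\le N}$ are independent, $H_{i,i}$ has law $P_N$ for all $i$, and $H_{i,j}$ has law $Q_N$ for all $i<j$. Put $H_N=H/\sqrt N$. Then for all $t>0$, $$\lim_{\varepsilon\to0^+}\ \limsup_{N\to+\infty}\ \frac{1}{N^{\alpha/2}}\log\mathbb{P}\left(\left|\lambda_{X_N}-\lambda_{H_N+C^{\varepsilon}}\right|>t\right)=-\infty,$$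 that is, $(\lambda_{H_N+C^{\varepsilon}})$ is an exponentially good approximation of $(\lambda_{X_N})$ at speed $N^{\alpha/2}$. -/

import Mathlib

open MeasureTheory ProbabilityTheory Filter Topology

noncomputable section

namespace HeavyWigner

/-- `|z|_∞ = max (|Re z|, |Im z|)`. -/
def supAbs (z : ℂ) : ℝ := max |z.re| |z.im|

/-- The largest eigenvalue of a Hermitian matrix (the largest element of its real spectrum). -/
def topEigenvalue {N : ℕ} (A : Matrix (Fin N) (Fin N) ℂ) : ℝ := sSup (spectrum ℝ A)

variable {Ω : Type*} [MeasurableSpace Ω]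

/-- For large values of `|Y|`, the modulus and the angle of `Y` are independent. -/
def AngleDecoupled (μ : Measure Ω) (Y : Ω → ℂ) : Prop :=
  ∃ υ : Measure (Metric.sphere (0 : ℂ) 1), IsProbabilityMeasure υ ∧
    ∃ t₀ : ℝ, 0 < t₀ ∧ ∀ t : ℝ, t₀ ≤ t → ∀ U : Set (Metric.sphere (0 : ℂ) 1), MeasurableSet U →
      μ {ω | Y ω / (‖Y ω‖ : ℂ) ∈ Subtype.val '' U ∧ t ≤ ‖Y ω‖} = υ U * μ {ω | t ≤ ‖Y ω‖}

/-- `lim_{t → ∞} -t^{-α} log P(|Y| > t) = c`. -/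
def HasTail (μ : Measure Ω) (α c : ℝ) (Y : Ω → ℂ) : Prop :=
  Tendsto (fun t : ℝ => -t ^ (-α) * Real.log (μ.real {ω | t < ‖Y ω‖})) atTop (𝓝 c)

/-- The entries `X i j`, `i ≤ j` (indices start at `0`), are those of a Wigner matrix without
Gaussian tails, with parameters `α`, `a`, `b`. The values `X i j` with `j < i` play no role. -/
structure IsWignerFamily (μ : Measure Ω) (X : ℕ → ℕ → Ω → ℂ) (α a b : ℝ) : Prop where
  measurable : ∀ i j, i ≤ j → Measurable (X i j)
  indep : iIndepFun (fun p : {p : ℕ × ℕ // p.1 ≤ p.2} => X p.1.1 p.1.2) μ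
  diag_real : ∀ i ω, (X i i ω).im = 0
  diag_ident : ∀ i, IdentDistrib (X i i) (X 0 0) μ μ
  offDiag_ident : ∀ i j, i < j → IdentDistrib (X i j) (X 0 1) μ μ
  mean_zero : ∫ ω, X 0 1 ω ∂μ = 0
  variance_one : ∫ ω, ‖X 0 1 ω‖ ^ 2 ∂μ = 1
  re_im_indep : IndepFun (fun ω => (X 0 1 ω).re) (fun ω => (X 0 1 ω).im) μ
  alpha_pos : 0 < α
  alpha_lt_two : α < 2
  a_pos : 0 < a
  b_pos : 0 < b
  diag_tail : HasTail μ α b (X 0 0)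
  offDiag_tail : HasTail μ α a (X 0 1)
  diag_angle : AngleDecoupled μ (X 0 0)
  offDiag_angle : AngleDecoupled μ (X 0 1)

/-- The (unnormalized) Hermitian matrix `X(N)` with entries `X i j` for `i ≤ j`. -/
def wignerMatrix (X : ℕ → ℕ → Ω → ℂ) (N : ℕ) (ω : Ω) : Matrix (Fin N) (Fin N) ℂ :=
  Matrix.of fun i j => if i ≤ j then X i j ω else star (X j i ω)

/-- Normalization by `√N`. -/
def normalized {N : ℕ} (M : Matrix (Fin N) (Fin N) ℂ) : Matrix (Fin N) (Fin N) ℂ :=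
  Matrix.of fun i j => M i j / (Real.sqrt N : ℂ)

open Classical in
/-- The matrix `C^ε`: entries `M i j / √N` for `ε √N ≤ |M i j|_∞ ≤ ε⁻¹ √N`, and `0` otherwise. -/
def largePart (ε : ℝ) {N : ℕ} (M : Matrix (Fin N) (Fin N) ℂ) : Matrix (Fin N) (Fin N) ℂ :=
  Matrix.of fun i j =>
    if ε * Real.sqrt N ≤ supAbs (M i j) ∧ supAbs (M i j) ≤ ε⁻¹ * Real.sqrt N
    then M i j / (Real.sqrt N : ℂ) else 0

/-- The law of `Y` conditioned on the event `|Y|_∞ ≤ (log N)^d`. -/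
def truncatedLaw (μ : Measure Ω) (d : ℝ) (N : ℕ) (Y : Ω → ℂ) : Measure ℂ :=
  (μ[|{ω | supAbs (Y ω) ≤ Real.log N ^ d}]).map Y

/-- `H` is a random Hermitian `N × N` matrix, independent of `X(N)`, whose entries on and above
the diagonal are independent, the diagonal ones having the law of `X 0 0` conditioned on
`|X 0 0|_∞ ≤ (log N)^d`, the ones above the diagonal that of `X 0 1` conditioned on
`|X 0 1|_∞ ≤ (log N)^d`. -/
structure IsTruncatedCopy (μ : Measure Ω) (X : ℕ → ℕ → Ω → ℂ) (d : ℝ) (N : ℕ)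
    (H : Ω → Matrix (Fin N) (Fin N) ℂ) : Prop where
  measurable : ∀ i j, Measurable (fun ω => H ω i j)
  hermitian : ∀ ω, (H ω).IsHermitian
  indep_X : IndepFun (fun ω (p : Fin N × Fin N) => H ω p.1 p.2)
    (fun ω (p : Fin N × Fin N) => wignerMatrix X N ω p.1 p.2) μ
  indep : iIndepFun (fun (p : {p : Fin N × Fin N // p.1 ≤ p.2}) ω => H ω p.1.1 p.1.2) μ
  diag_law : ∀ i, μ.map (fun ω => H ω i i) = truncatedLaw μ d N (X 0 0)
  offDiag_law : ∀ i j, i < j → μ.map (fun ω => H ω i j) = truncatedLaw μ d N (X 0 1)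

end HeavyWigner

end

/-! Write `L = (log N)^d` and `r = √N`. Replace every entry of `X` with `|X_{ij}|_∞ > L` by the
corresponding entry of `H`, and call the result `R` (`resample`). Let `O` (`overflow`) keep the
entries of `X` above `L` and vanish elsewhere. The proof compares `X_N` with `R/r + C^ε`, and then
`R/r + C^ε` with `H_N + C^ε`.

The first comparison is a perturbation bound. The largest eigenvalue is Lipschitz for the
Hilbert–Schmidt norm, and the squared norm of the difference is at most a constant times a sum of
independent error weights (`norm_sub_resample_sq_le`), as long as no entry exceeds `ε⁻¹ r`. A weight
is nonzero only above `L`, and it is small compared with `s^α / r^α` when `ε` is small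
(`mul_errorWeight_le`). The tail assumption provides a moment of `exp(η|Y|^α)`, so Chernoff's bound
applies with a factor `K r^α` in the exponent, for any `K` once `ε` is small. The condition `dα > 1`
makes `N² exp(-κ L^α)` negligible.

The second comparison rests on an identity in law. For each entry, conditioning on being at most `L`
gives the law of `H`, so `R` is independent of `O`, and `(R, O)` and `(H, O)` have the same law
(`map_resample_overflow`). Since `L < ε r`, the matrix `C^ε` is a function of `O`. With `O` frozen,
the largest eigenvalue is convex and Lipschitz in the bounded independent entries, hence
concentrates around some `m(O)` by Maurey's convex `τ`-property (`convexTau_pi`,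
`exists_measurable_concentration`). Both eigenvalues are therefore close to the same `m(O)`, and no
expectation has to be computed. The error is `exp(-c N / L²)`, negligible at speed `N^(α/2)` because
`α < 2`. -/

namespace HeavyWigner

/-! ### The largest eigenvalue as a convex Lipschitz function of the upper triangular entries -/

open scoped ComplexOrder in
/-- The largest eigenvalue is at most `c` iff the quadratic form is at most `c` times the square of
the norm. -/
lemma topEigenvalue_le_iff {N : ℕ} [NeZero N] {A : Matrix (Fin N) (Fin N) ℂ}
    (hA : A.IsHermitian) (c : ℝ) :
    topEigenvalue A ≤ c ↔
      ∀ v : Fin N → ℂ, (star v ⬝ᵥ A.mulVec v).re ≤ c * ∑ i, ‖v i‖ ^ 2 := by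
  have hne : (spectrum ℝ A).Nonempty := by
    rw [hA.spectrum_real_eq_range_eigenvalues]
    exact Set.range_nonempty _
  have hB : (algebraMap ℝ (Matrix (Fin N) (Fin N) ℂ) c - A).IsHermitian := by
    refine Matrix.IsHermitian.sub ?_ hA
    rw [Algebra.algebraMap_eq_smul_one]
    simp [Matrix.IsHermitian, Matrix.conjTranspose_smul]
  have h1 : topEigenvalue A ≤ c ↔
      (algebraMap ℝ (Matrix (Fin N) (Fin N) ℂ) c - A).PosSemidef := by
    rw [hB.posSemidef_iff_eigenvalues_nonneg, topEigenvalue,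
      csSup_le_iff A.finite_real_spectrum.bddAbove hne]
    constructor
    · intro h i
      have hi := hB.eigenvalues_mem_spectrum_real i
      rw [← spectrum.singleton_sub_eq] at hi
      obtain ⟨_, rfl, x, hx, hxe⟩ := hi
      simp only [Pi.zero_apply, ← hxe, sub_nonneg]
      exact h x hx
    · intro h x hx
      have hi : c - x ∈ spectrum ℝ (algebraMap ℝ (Matrix (Fin N) (Fin N) ℂ) c - A) := by
        rw [← spectrum.singleton_sub_eq]
        exact ⟨c, rfl, x, hx, rfl⟩
      rw [hB.spectrum_real_eq_range_eigenvalues] at hi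
      obtain ⟨i, hi⟩ := hi
      have := h i
      simp only [Pi.zero_apply, hi, sub_nonneg] at this
      exact this
  rw [h1, Matrix.posSemidef_iff_dotProduct_mulVec]
  have key : ∀ v : Fin N → ℂ,
      (star v ⬝ᵥ (algebraMap ℝ (Matrix (Fin N) (Fin N) ℂ) c - A).mulVec v).re
        = c * ∑ i, ‖v i‖ ^ 2 - (star v ⬝ᵥ A.mulVec v).re := by
    intro v
    rw [Matrix.sub_mulVec, dotProduct_sub, Complex.sub_re, Algebra.algebraMap_eq_smul_one,
      Matrix.smul_mulVec, Matrix.one_mulVec, dotProduct_smul]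
    congr 1
    simp only [dotProduct, Complex.real_smul, Complex.re_ofReal_mul, Complex.re_sum]
    congr 1
    refine Finset.sum_congr rfl fun i _ => ?_
    simp only [Pi.star_apply, RCLike.star_def, Complex.conj_mul']
    norm_cast
  constructor
  · rintro ⟨_, h⟩ v
    have := (Complex.le_def.1 (h v)).1
    rw [key, Complex.zero_re] at this
    linarith
  · intro h
    refine ⟨hB, fun v => ?_⟩
    rw [Complex.le_def]
    refine ⟨?_, ?_⟩
    · rw [key, Complex.zero_re]
      linarith [h v]
    · exact (hB.im_star_dotProduct_mulVec_self v).symm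

/-- Cauchy–Schwarz for a quadratic form, with the Hilbert–Schmidt norm. -/
lemma re_dotProduct_mulVec_le {N : ℕ} (A : Matrix (Fin N) (Fin N) ℂ) (v : Fin N → ℂ) :
    (star v ⬝ᵥ A.mulVec v).re ≤ √(∑ i, ∑ j, ‖A i j‖ ^ 2) * ∑ i, ‖v i‖ ^ 2 := by
  have h1 : (star v ⬝ᵥ A.mulVec v).re ≤ ∑ p : Fin N × Fin N, ‖A p.1 p.2‖ * (‖v p.1‖ * ‖v p.2‖) := by
    refine (Complex.re_le_norm _).trans ?_
    rw [Fintype.sum_prod_type]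
    refine (norm_sum_le _ _).trans (Finset.sum_le_sum fun i _ => ?_)
    rw [Matrix.mulVec, dotProduct, Finset.mul_sum]
    refine (norm_sum_le _ _).trans (Finset.sum_le_sum fun j _ => ?_)
    simp only [Pi.star_apply, norm_mul, norm_star]
    exact le_of_eq (by ring)
  have h2 := Finset.sum_mul_sq_le_sq_mul_sq (Finset.univ : Finset (Fin N × Fin N))
    (fun p => ‖A p.1 p.2‖) (fun p => ‖v p.1‖ * ‖v p.2‖)
  have h3 : ∑ p : Fin N × Fin N, (‖v p.1‖ * ‖v p.2‖) ^ 2 = (∑ i, ‖v i‖ ^ 2) ^ 2 := by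
    rw [Fintype.sum_prod_type, sq, Finset.sum_mul_sum]
    simp only [mul_pow]
  rw [h3, Fintype.sum_prod_type (fun p : Fin N × Fin N => ‖A p.1 p.2‖ ^ 2)] at h2
  refine h1.trans ((Real.le_sqrt_of_sq_le h2).trans ?_)
  rw [Real.sqrt_mul (by positivity), Real.sqrt_sq (by positivity)]

/-- The Hermitian matrix with prescribed entries on and above the diagonal; the imaginary parts on
the diagonal are dropped. -/
def hermOf {N : ℕ} (w : {p : Fin N × Fin N // p.1 ≤ p.2} → ℂ) : Matrix (Fin N) (Fin N) ℂ :=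
  Matrix.of fun i j =>
    if h : i < j then w ⟨(i, j), h.le⟩
    else if h : j < i then star (w ⟨(j, i), h.le⟩) else ((w ⟨(i, i), le_rfl⟩).re : ℂ)

lemma hermOf_isHermitian {N : ℕ} (w : {p : Fin N × Fin N // p.1 ≤ p.2} → ℂ) :
    (hermOf w).IsHermitian := by
  ext i j
  simp only [hermOf, Matrix.conjTranspose_apply, Matrix.of_apply]
  rcases lt_trichotomy i j with h | rfl | h
  · simp [h, h.not_gt]
  · simp
  · simp [h, h.not_gt]

lemma hermOf_eq {N : ℕ} {M : Matrix (Fin N) (Fin N) ℂ} (hM : M.IsHermitian) :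
    hermOf (fun p => M p.1.1 p.1.2) = M := by
  ext i j
  simp only [hermOf, Matrix.of_apply]
  rcases lt_trichotomy i j with h | rfl | h
  · simp [h]
  · simp only [lt_irrefl, dite_false]
    exact hM.coe_re_apply_self i
  · simp only [h, h.not_gt, dite_false, dite_true]
    exact hM.apply i j

lemma hermOf_sub {N : ℕ} (w w' : {p : Fin N × Fin N // p.1 ≤ p.2} → ℂ) :
    hermOf w - hermOf w' = hermOf (w - w') := by
  ext i j
  simp only [hermOf, Matrix.of_apply, Matrix.sub_apply]
  split_ifs <;> simp

lemma hermOf_comb {N : ℕ} (w w' : {p : Fin N × Fin N // p.1 ≤ p.2} → ℂ) (s r : ℝ) :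
    hermOf (s • w + r • w') = s • hermOf w + r • hermOf w' := by
  ext i j
  simp only [hermOf, Matrix.of_apply, Matrix.add_apply, Matrix.smul_apply]
  split_ifs <;> simp

/-- Each off-diagonal coordinate appears twice in the matrix, and passing to real parts on the
diagonal only decreases the norm. -/
lemma sum_norm_sq_hermOf_le {N : ℕ} (w : {p : Fin N × Fin N // p.1 ≤ p.2} → ℂ) :
    ∑ i, ∑ j, ‖hermOf w i j‖ ^ 2 ≤ 2 * ∑ p, ‖w p‖ ^ 2 := by
  let g : Fin N × Fin N → ℝ := fun p => if h : p.1 ≤ p.2 then ‖w ⟨p, h⟩‖ ^ 2 else 0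
  have hg : ∑ p, g p = ∑ p, ‖w p‖ ^ 2 := by
    rw [← Fintype.sum_subtype_add_sum_subtype (fun p : Fin N × Fin N => p.1 ≤ p.2) g,
      Finset.sum_eq_zero (f := fun p : {p : Fin N × Fin N // ¬p.1 ≤ p.2} => g p)
        fun p _ => dif_neg p.2, add_zero]
    exact Finset.sum_congr rfl fun p _ => dif_pos p.2
  have h0 : ∀ p, 0 ≤ g p := fun p => by simp only [g]; split_ifs <;> positivity
  have h1 : ∀ i j, ‖hermOf w i j‖ ^ 2 ≤ g (i, j) + g (j, i) := by
    intro i j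
    have e1 := h0 (i, j)
    have e2 := h0 (j, i)
    rcases lt_trichotomy i j with h | rfl | h
    · have : g (i, j) = ‖hermOf w i j‖ ^ 2 := by simp [g, hermOf, h, h.le]
      linarith
    · have : ‖hermOf w i i‖ ^ 2 ≤ g (i, i) := by
        simp only [hermOf, g, Matrix.of_apply, lt_irrefl, dite_false, le_refl, dite_true]
        have := Complex.abs_re_le_norm (w ⟨(i, i), le_rfl⟩)
        rw [Complex.norm_real, Real.norm_eq_abs]
        gcongr
      linarith
    · have : g (j, i) = ‖hermOf w i j‖ ^ 2 := by simp [g, hermOf, h, h.le, h.not_gt]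
      linarith
  calc ∑ i, ∑ j, ‖hermOf w i j‖ ^ 2 ≤ ∑ i, ∑ j, (g (i, j) + g (j, i)) :=
        Finset.sum_le_sum fun i _ => Finset.sum_le_sum fun j _ => h1 i j
    _ = ∑ p, g p + ∑ p, g p := by
        simp only [Finset.sum_add_distrib, Fintype.sum_prod_type]
        rw [Finset.sum_comm (f := fun i j => g (j, i))]
    _ = 2 * ∑ p, ‖w p‖ ^ 2 := by rw [hg]; ring

/-- The largest eigenvalue as a function of the entries on and above the diagonal. -/
noncomputable def topOf {N : ℕ} (w : {p : Fin N × Fin N // p.1 ≤ p.2} → ℂ) : ℝ := topEigenvalue (hermOf w)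

lemma topOf_le_add {N : ℕ} [NeZero N] (w w' : {p : Fin N × Fin N // p.1 ≤ p.2} → ℂ) :
    topOf w ≤ topOf w' + √(2 * ∑ p, ‖w p - w' p‖ ^ 2) := by
  rw [topOf, topEigenvalue_le_iff (hermOf_isHermitian w)]
  intro v
  have h1 := (topEigenvalue_le_iff (hermOf_isHermitian w') _).1 le_rfl v
  have h2 := re_dotProduct_mulVec_le (hermOf (w - w')) v
  have h3 := Real.sqrt_le_sqrt (sum_norm_sq_hermOf_le (w - w'))
  have h4 : (0 : ℝ) ≤ ∑ i, ‖v i‖ ^ 2 := by positivity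
  rw [← hermOf_sub, Matrix.sub_mulVec, dotProduct_sub, Complex.sub_re, hermOf_sub] at h2
  have h5 := mul_le_mul_of_nonneg_right h3 h4
  simp only [Pi.sub_apply] at h5
  rw [add_mul]
  change _ ≤ topEigenvalue (hermOf w') * _ + _
  linarith

lemma abs_topOf_sub_le {N : ℕ} [NeZero N] (w w' : {p : Fin N × Fin N // p.1 ≤ p.2} → ℂ) :
    |topOf w - topOf w'| ≤ √(2 * ∑ p, ‖w p - w' p‖ ^ 2) := by
  rw [abs_sub_le_iff]
  constructor
  · linarith [topOf_le_add w w']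
  · have := topOf_le_add w' w
    simp only [norm_sub_rev (w' _)] at this
    linarith

/-- By the variational characterization, the largest eigenvalue is a supremum of quadratic forms
that are real-linear in the entries. -/
lemma convexOn_topOf {N : ℕ} [NeZero N] :
    ConvexOn ℝ Set.univ (topOf : ({p : Fin N × Fin N // p.1 ≤ p.2} → ℂ) → ℝ) := by
  refine ⟨convex_univ, fun w _ w' _ s r hs hr _ => ?_⟩
  rw [topOf, topEigenvalue_le_iff (hermOf_isHermitian _)]
  intro v
  have h1 := (topEigenvalue_le_iff (hermOf_isHermitian w) _).1 le_rfl v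
  have h2 := (topEigenvalue_le_iff (hermOf_isHermitian w') _).1 le_rfl v
  rw [hermOf_comb, Matrix.add_mulVec, Matrix.smul_mulVec, Matrix.smul_mulVec, dotProduct_add,
    dotProduct_smul, dotProduct_smul]
  simp only [Complex.add_re, Complex.real_smul, Complex.re_ofReal_mul, smul_eq_mul, topOf]
  nlinarith [mul_le_mul_of_nonneg_left h1 hs, mul_le_mul_of_nonneg_left h2 hr]

end HeavyWigner

/-! ### Infimum convolution, the convex `τ`-property and its tensorization -/

namespace HeavyWigner

/-- The scalar inequality behind the tensorization step: `r` will be a ratio of two partial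
integrals and `θ` an interpolation weight. The right side is affine in `r`, so it can be integrated
afterwards. -/
lemma exists_rpow_neg_mul_exp_le {r : ℝ} (hr : 0 < r) (hr1 : r ≤ 1) :
    ∃ θ : ℝ, 0 ≤ θ ∧ θ ≤ 1 ∧ r ^ (-θ) * Real.exp ((1 - θ) ^ 2 / 8) ≤ 2 - r := by
  obtain ⟨u, rfl⟩ : ∃ u, r = Real.exp (-u) := ⟨-Real.log r, by simp [Real.exp_log hr]⟩
  have hu : 0 ≤ u := by
    have := Real.exp_le_one_iff.1 hr1
    linarith
  have inv_bound : ∀ x : ℝ, 0 ≤ x → Real.exp (-x) * (1 + x) ≤ 1 := fun x hx => by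
    have h1 := Real.add_one_le_exp x
    have h2 : Real.exp (-x) * Real.exp x = 1 := by rw [← Real.exp_add]; simp
    nlinarith [Real.exp_pos (-x)]
  have exp_bound : ∀ x : ℝ, Real.exp x * (1 - x) ≤ 1 := fun x => by
    have h1 := Real.add_one_le_exp (-x)
    have h2 : Real.exp (-x) * Real.exp x = 1 := by rw [← Real.exp_add]; simp
    nlinarith [Real.exp_pos x]
  by_cases h : u ≤ 1 / 4
  -- This `θ` minimizes the exponent `θ u + (1 - θ)² / 8`, and the minimum is `u - 2u²`.
  · refine ⟨1 - 4 * u, by linarith, by linarith, ?_⟩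
    rw [← Real.exp_mul, ← Real.exp_add]
    have e1 : -u * -(1 - 4 * u) + (1 - (1 - 4 * u)) ^ 2 / 8 = u + -(2 * u ^ 2) := by ring
    rw [e1, Real.exp_add]
    have h1 := inv_bound (2 * u ^ 2) (by positivity)
    have h2 := Real.cosh_le_exp_half_sq u
    rw [Real.cosh_eq] at h2
    have h3 : Real.exp (u ^ 2 / 2) ≤ 1 + u ^ 2 := by
      have := exp_bound (u ^ 2 / 2)
      have h5 : u ^ 2 ≤ 1 / 16 := by nlinarith
      have h6 : 0 < 1 - u ^ 2 / 2 := by linarith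
      refine le_of_mul_le_mul_right (this.trans ?_) h6
      nlinarith [sq_nonneg u]
    have h4 : Real.exp (-u) ≤ 1 := hr1
    have h5 : Real.exp u * (Real.exp (-(2 * u ^ 2)) * (1 + 2 * u ^ 2)) ≤ Real.exp u * 1 :=
      mul_le_mul_of_nonneg_left h1 (Real.exp_pos u).le
    have h6 : 0 < 1 + 2 * u ^ 2 := by positivity
    -- The bound on `cosh` gives `exp u ≤ 2 - exp (-u) + 2u²`, and the term `2u²` is paid for by `2
    -- - exp (-u) ≥ 1`.
    have h7 : (Real.exp u * Real.exp (-(2 * u ^ 2))) * (1 + 2 * u ^ 2)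
        ≤ (2 - Real.exp (-u)) * (1 + 2 * u ^ 2) := by
      nlinarith [sq_nonneg u]
    exact le_of_mul_le_mul_right h7 h6
  · push Not at h
    -- The minimizer would be negative, so the endpoint is used: `exp (1/8) ≤ 8/7 ≤ 2 - 4/5 ≤ 2 -
    -- r`.
    refine ⟨0, le_rfl, zero_le_one, ?_⟩
    have h1 := exp_bound (1 / 8)
    have h2 := inv_bound (1 / 4) (by norm_num)
    have h3 : Real.exp (-u) ≤ Real.exp (-(1 / 4)) := Real.exp_le_exp.2 (by linarith)
    simp only [neg_zero, Real.rpow_zero, one_mul, sub_zero, one_pow]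
    linarith

/-- The infimal convolution of `f` with the cost `c`. -/
noncomputable def infConv {E : Type*} [Sub E] (c f : E → ℝ) (x : E) : ℝ :=
  ⨅ y, f y + c (x - y)

/-- The convex `τ`-property of a measure with respect to the cost `c`. -/
def ConvexTau {E : Type*} [AddCommGroup E] [Module ℝ E] [TopologicalSpace E] [MeasurableSpace E]
    (μ : Measure E) (c : E → ℝ) : Prop :=
  ∀ f : E → ℝ, ConvexOn ℝ Set.univ f → Continuous f → BddBelow (Set.range f) →
    (∫⁻ x, ENNReal.ofReal (Real.exp (infConv c f x)) ∂μ) *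
      (∫⁻ x, ENNReal.ofReal (Real.exp (-f x)) ∂μ) ≤ 1

lemma bddBelow_infConv {E : Type*} [Sub E] {c f : E → ℝ} (hc : ∀ x, 0 ≤ c x)
    (hf : BddBelow (Set.range f)) (x : E) : BddBelow (Set.range fun y => f y + c (x - y)) := by
  obtain ⟨b, hb⟩ := hf
  refine ⟨b, ?_⟩
  rintro _ ⟨y, rfl⟩
  exact (hb ⟨y, rfl⟩).trans (le_add_of_nonneg_right (hc _))

lemma infConv_le {E : Type*} [Sub E] {c f : E → ℝ} (hc : ∀ x, 0 ≤ c x)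
    (hf : BddBelow (Set.range f)) (x y : E) : infConv c f x ≤ f y + c (x - y) :=
  ciInf_le (bddBelow_infConv hc hf x) y

lemma measurable_infConv {E : Type*} [NormedAddCommGroup E] [MeasurableSpace E] [BorelSpace E]
    {c f : E → ℝ} (hc : ∀ x, 0 ≤ c x) (hcc : Continuous c) (hf : BddBelow (Set.range f)) :
    Measurable (infConv c f) := by
  refine UpperSemicontinuous.measurable ?_
  refine upperSemicontinuous_ciInf (bddBelow_infConv hc hf) fun y => ?_
  exact Continuous.upperSemicontinuous (by fun_prop)

lemma ConvexTau.map {E F : Type*} [AddCommGroup E] [Module ℝ E] [TopologicalSpace E]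
    [MeasurableSpace E] [AddCommGroup F] [Module ℝ F] [TopologicalSpace F] [MeasurableSpace F]
    {μ : Measure E} {ν : Measure F} {c : E → ℝ} {c' : F → ℝ} (h : ConvexTau μ c)
    (e : E →L[ℝ] F) (he : Function.Surjective e) (heq : MeasurableEmbedding e)
    (hmp : μ.map e = ν) (hc : ∀ x, c' (e x) = c x) : ConvexTau ν c' := by
  intro f hf hfc hfb
  have h1 := h (f ∘ e) (hf.comp_linearMap e.toLinearMap) (hfc.comp e.continuous)
    (hfb.mono (Set.range_comp_subset_range _ _))
  have h2 : ∀ x, infConv c (f ∘ e) x = infConv c' f (e x) := by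
    intro x
    rw [infConv, infConv, ← he.iInf_comp]
    simp [← hc, map_sub]
  simp only [h2, Function.comp_apply] at h1
  rwa [← hmp, heq.lintegral_map, heq.lintegral_map]

lemma ConvexTau.of_subsingleton {E : Type*} [AddCommGroup E] [Module ℝ E] [TopologicalSpace E]
    [MeasurableSpace E] [Subsingleton E] (μ : Measure E) [IsProbabilityMeasure μ] {c : E → ℝ}
    (hc : c 0 = 0) : ConvexTau μ c := by
  intro f _ _ _
  have h1 : ∀ x, infConv c f x = f 0 := fun x => by
    have : ∀ y, f y + c (x - y) = f 0 := fun y => by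
      rw [Subsingleton.elim (x - y) 0, hc, Subsingleton.elim y 0, add_zero]
    simp [infConv, this]
  have h2 : ∀ x, f x = f 0 := fun x => by rw [Subsingleton.elim x 0]
  simp only [h1, h2]
  rw [lintegral_const, lintegral_const, measure_univ, mul_one, mul_one,
    ← ENNReal.ofReal_mul (Real.exp_pos _).le, ← Real.exp_add]
  simp

section Product

variable {E : Type*} [NormedAddCommGroup E] [NormedSpace ℝ E]

/-- Test the joint infimum at `θ(y, z) + (1 - θ)(y₀, z₀)`. Convexity of `f` and `c` separates the
two slices, and only the displacement `(1 - θ)(y - y₀)` is paid in the first coordinate. -/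
lemma infConv_prod_le {c : E → ℝ} (hc : ∀ x, 0 ≤ c x) (hcv : ConvexOn ℝ Set.univ c) {κ : ℝ}
    (hκ : 0 ≤ κ) {f : ℂ × E → ℝ} (hf : ConvexOn ℝ Set.univ f) (hfb : BddBelow (Set.range f))
    {θ : ℝ} (hθ0 : 0 ≤ θ) (hθ1 : θ ≤ 1) (y y₀ : ℂ) (x : E) :
    infConv (fun p : ℂ × E => κ * ‖p.1‖ ^ 2 + c p.2) f (y, x) ≤
      θ * infConv c (fun z => f (y, z)) x + (1 - θ) * infConv c (fun z => f (y₀, z)) x +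
        κ * ‖y - y₀‖ ^ 2 * (1 - θ) ^ 2 := by
  have hθ2 : 0 ≤ 1 - θ := by linarith
  rw [infConv, infConv, infConv, Real.mul_iInf_of_nonneg hθ0, Real.mul_iInf_of_nonneg hθ2,
    ← sub_le_iff_le_add]
  refine le_ciInf_add_ciInf fun z z₀ => ?_
  rw [sub_le_iff_le_add]
  have h1 := infConv_le (c := fun p : ℂ × E => κ * ‖p.1‖ ^ 2 + c p.2)
    (fun p => add_nonneg (by positivity) (hc _)) hfb (y, x) (θ • (y, z) + (1 - θ) • (y₀, z₀))
  refine h1.trans ?_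
  have h2 := hf.2 (Set.mem_univ (y, z)) (Set.mem_univ (y₀, z₀)) hθ0 hθ2 (by ring)
  have h3 := hcv.2 (Set.mem_univ (x - z)) (Set.mem_univ (x - z₀)) hθ0 hθ2 (by ring)
  have e1 : (((y, x) : ℂ × E) - (θ • (y, z) + (1 - θ) • (y₀, z₀))).1 = (1 - θ) • (y - y₀) := by
    simp only [Prod.fst_sub, Prod.fst_add, Prod.smul_fst]
    module
  have e2 : (((y, x) : ℂ × E) - (θ • (y, z) + (1 - θ) • (y₀, z₀))).2
      = θ • (x - z) + (1 - θ) • (x - z₀) := by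
    simp only [Prod.snd_sub, Prod.snd_add, Prod.smul_snd]
    module
  simp only [e1, e2, norm_smul, Real.norm_eq_abs, mul_pow, sq_abs]
  simp only [smul_eq_mul] at h2 h3
  linarith

variable [MeasurableSpace E] [BorelSpace E] [SecondCountableTopology E]

/-- Let `F y` be the integral of `exp(-f)` over the slice at `y`. Interpolating between the slice at
`y` and the slice where `F` is largest, Hölder's inequality and the property of `μ` bound the inner
integral by an affine function of `F y`. Integrating in `y` then closes the estimate. -/
lemma ConvexTau.prod {c : E → ℝ} (hc : ∀ x, 0 ≤ c x) (hcv : ConvexOn ℝ Set.univ c)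
    (hcc : Continuous c) {μ : Measure E} [IsProbabilityMeasure μ] (hμ : ConvexTau μ c)
    {ν : Measure ℂ} [IsProbabilityMeasure ν] {S : Set ℂ} (hS : IsCompact S) (hνS : ∀ᵐ y ∂ν, y ∈ S)
    {κ : ℝ} (hκ : 0 ≤ κ) (hκS : ∀ y ∈ S, ∀ y' ∈ S, κ * ‖y - y'‖ ^ 2 ≤ 1 / 8) :
    ConvexTau (ν.prod μ) (fun p : ℂ × E => κ * ‖p.1‖ ^ 2 + c p.2) := by
  intro f hf hfc hfb
  obtain ⟨b, hb⟩ := hfb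
  have hb' : ∀ p, b ≤ f p := fun p => hb ⟨p, rfl⟩
  have hfy : ∀ y, ConvexOn ℝ Set.univ (fun z => f (y, z)) := by
    intro y
    refine ⟨convex_univ, fun z _ z' _ s r hs hr hsr => ?_⟩
    have h := hf.2 (Set.mem_univ (y, z)) (Set.mem_univ (y, z')) hs hr hsr
    have e : s • (y, z) + r • (y, z') = (y, s • z + r • z') := by
      ext1
      · simp only [Prod.fst_add, Prod.smul_fst, ← add_smul, hsr, one_smul]
      · rfl
    rwa [e] at h
  have hfyb : ∀ y, BddBelow (Set.range fun z => f (y, z)) := fun y =>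
    ⟨b, by rintro _ ⟨z, rfl⟩; exact hb' _⟩
  have hfyc : ∀ y, Continuous fun z => f (y, z) := fun y => by fun_prop
  have hexp_int : ∀ y, Integrable (fun z => Real.exp (-f (y, z))) μ := fun y =>
    Integrable.of_bound (Continuous.aestronglyMeasurable (by fun_prop)) (Real.exp (-b))
      (ae_of_all _ fun z => by
        rw [Real.norm_eq_abs, Real.abs_exp]
        exact Real.exp_le_exp.2 (neg_le_neg (hb' _)))
  set F : ℂ → ℝ := fun y => ∫ z, Real.exp (-f (y, z)) ∂μ with hF
  have hFpos : ∀ y, 0 < F y := fun y => integral_exp_pos (hexp_int y)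
  have hFcont : Continuous F := by
    refine continuous_of_dominated (bound := fun _ => Real.exp (-b)) (fun y =>
      (hexp_int y).aestronglyMeasurable) (fun y => ae_of_all _ fun z => ?_) (integrable_const _)
      (ae_of_all _ fun z => by fun_prop)
    rw [Real.norm_eq_abs, Real.abs_exp]
    exact Real.exp_le_exp.2 (neg_le_neg (hb' _))
  have hFlint : ∀ y, ∫⁻ z, ENNReal.ofReal (Real.exp (-f (y, z))) ∂μ = ENNReal.ofReal (F y) :=
    fun y => (ofReal_integral_eq_lintegral_ofReal (hexp_int y)
      (ae_of_all _ fun _ => (Real.exp_pos _).le)).symm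
  have hSne : S.Nonempty := hνS.exists
  -- Maximality makes the ratio `F y / F y₀` at most `1`, as the scalar inequality requires.
  obtain ⟨y₀, hy₀, hmax⟩ := hS.exists_isMaxOn hSne hFcont.continuousOn
  have hFle : ∀ y ∈ S, F y ≤ F y₀ := fun y hy => hmax hy
  have hFint : Integrable F ν := by
    refine Integrable.of_bound hFcont.aestronglyMeasurable (F y₀) ?_
    filter_upwards [hνS] with y hy
    rw [Real.norm_eq_abs, abs_of_pos (hFpos y)]
    exact hFle y hy
  have hA : ∀ y, ∫⁻ z, ENNReal.ofReal (Real.exp (infConv c (fun z => f (y, z)) z)) ∂μ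
      ≤ ENNReal.ofReal (F y)⁻¹ := by
    intro y
    have h := hμ _ (hfy y) (hfyc y) (hfyb y)
    rw [hFlint] at h
    rw [ENNReal.ofReal_inv_of_pos (hFpos y)]
    exact ENNReal.le_inv_iff_mul_le.2 h
  have hmeas : ∀ y, Measurable (fun z =>
      ENNReal.ofReal (Real.exp (infConv c (fun z => f (y, z)) z))) := fun y =>
    (Real.measurable_exp.comp (measurable_infConv hc hcc (hfyb y))).ennreal_ofReal
  have hG : ∀ y ∈ S, ∫⁻ z, ENNReal.ofReal (Real.exp
      (infConv (fun p : ℂ × E => κ * ‖p.1‖ ^ 2 + c p.2) f (y, z))) ∂μ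
      ≤ ENNReal.ofReal ((2 - F y / F y₀) / F y₀) := by
    intro y hy
    obtain ⟨θ, hθ0, hθ1, hθ⟩ := exists_rpow_neg_mul_exp_le (div_pos (hFpos y) (hFpos y₀))
      ((div_le_one (hFpos y₀)).2 (hFle y hy))
    have hθ2 : 0 ≤ 1 - θ := by linarith
    have step : ∀ z, ENNReal.ofReal (Real.exp
        (infConv (fun p : ℂ × E => κ * ‖p.1‖ ^ 2 + c p.2) f (y, z))) ≤
        ENNReal.ofReal (Real.exp ((1 - θ) ^ 2 / 8)) *
        (ENNReal.ofReal (Real.exp (infConv c (fun z => f (y, z)) z)) ^ θ *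
         ENNReal.ofReal (Real.exp (infConv c (fun z => f (y₀, z)) z)) ^ (1 - θ)) := by
      intro z
      rw [ENNReal.ofReal_rpow_of_pos (Real.exp_pos _), ENNReal.ofReal_rpow_of_pos (Real.exp_pos _),
        ← Real.exp_mul, ← Real.exp_mul, ← ENNReal.ofReal_mul (Real.exp_pos _).le, ← Real.exp_add,
        ← ENNReal.ofReal_mul (Real.exp_pos _).le, ← Real.exp_add]
      refine ENNReal.ofReal_le_ofReal (Real.exp_le_exp.2 ?_)
      have h1 := infConv_prod_le hc hcv hκ hf ⟨b, hb⟩ hθ0 hθ1 y y₀ z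
      have h2 := mul_le_mul_of_nonneg_right (hκS y hy y₀ hy₀) (sq_nonneg (1 - θ))
      linarith
    refine (lintegral_mono step).trans ?_
    rw [lintegral_const_mul' _ _ ENNReal.ofReal_ne_top]
    have h1 := ENNReal.lintegral_mul_norm_pow_le (hmeas y).aemeasurable (hmeas y₀).aemeasurable
      (μ := μ) hθ0 hθ2 (by ring)
    refine (mul_le_mul_right h1 _).trans ?_
    refine (mul_le_mul_right (mul_le_mul' (ENNReal.rpow_le_rpow (hA y) hθ0)
      (ENNReal.rpow_le_rpow (hA y₀) hθ2)) _).trans ?_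
    have p1 := inv_pos.2 (hFpos y)
    have p2 := inv_pos.2 (hFpos y₀)
    rw [ENNReal.ofReal_rpow_of_pos p1, ENNReal.ofReal_rpow_of_pos p2,
      ← ENNReal.ofReal_mul (by positivity), ← ENNReal.ofReal_mul (by positivity)]
    refine ENNReal.ofReal_le_ofReal ?_
    have e1 : (F y)⁻¹ ^ θ * (F y₀)⁻¹ ^ (1 - θ) = (F y / F y₀) ^ (-θ) * (F y₀)⁻¹ := by
      rw [Real.rpow_neg (div_pos (hFpos y) (hFpos y₀)).le, ← Real.inv_rpow
        (div_pos (hFpos y) (hFpos y₀)).le, inv_div, div_eq_mul_inv,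
        Real.mul_rpow (hFpos y₀).le p1.le, Real.rpow_sub p2, Real.rpow_one,
        Real.inv_rpow (hFpos y₀).le]
      have := Real.rpow_pos_of_pos (hFpos y₀) θ
      field_simp
    rw [e1, div_eq_mul_inv (2 - F y / F y₀)]
    have := mul_le_mul_of_nonneg_right hθ p2.le
    linarith
  have hI : Integrable (fun y => (2 - F y / F y₀) / F y₀) ν :=
    (((integrable_const _).sub (hFint.div_const _)).div_const _)
  have hfin1 : ∫⁻ p, ENNReal.ofReal (Real.exp
      (infConv (fun p : ℂ × E => κ * ‖p.1‖ ^ 2 + c p.2) f p)) ∂(ν.prod μ)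
      ≤ ENNReal.ofReal ((2 - (∫ y, F y ∂ν) / F y₀) / F y₀) := by
    refine (lintegral_prod_le _).trans ?_
    refine (lintegral_mono_ae (hνS.mono hG)).trans ?_
    rw [← ofReal_integral_eq_lintegral_ofReal hI, integral_div,
      integral_sub (integrable_const _) (hFint.div_const _), integral_div]
    · simp
    · filter_upwards [hνS] with y hy
      have := (div_le_one (hFpos y₀)).2 (hFle y hy)
      have := hFpos y₀
      simp only [Pi.zero_apply]
      apply div_nonneg <;> linarith
  have hfin2 : ∫⁻ p, ENNReal.ofReal (Real.exp (-f p)) ∂(ν.prod μ)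
      = ENNReal.ofReal (∫ y, F y ∂ν) := by
    rw [lintegral_prod _ (Continuous.measurable (by fun_prop)).ennreal_ofReal.aemeasurable]
    simp only [hFlint]
    rw [ofReal_integral_eq_lintegral_ofReal hFint (ae_of_all _ fun y => (hFpos y).le)]
  have hInn : 0 ≤ ∫ y, F y ∂ν := integral_nonneg fun y => (hFpos y).le
  rw [hfin2]
  refine (mul_le_mul_left hfin1 _).trans ?_
  rw [← ENNReal.ofReal_mul' hInn, ← ENNReal.ofReal_one]
  refine ENNReal.ofReal_le_ofReal ?_
  have e : (2 - (∫ y, F y ∂ν) / F y₀) / F y₀ * ∫ y, F y ∂ν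
      = (2 - (∫ y, F y ∂ν) / F y₀) * ((∫ y, F y ∂ν) / F y₀) := by ring
  rw [e]
  -- With `q = (∫ F) / F y₀`, this is `(2 - q) q ≤ 1`.
  nlinarith [sq_nonneg (1 - (∫ y, F y ∂ν) / F y₀)]

end Product

/-- Maurey's theorem: a product of compactly supported probability measures on `ℂ` has the convex
`τ`-property with respect to a quadratic cost. -/
theorem convexTau_pi {κ : ℝ} (hκ : 0 ≤ κ) {S : Set ℂ} (hS : IsCompact S)
    (hκS : ∀ y ∈ S, ∀ y' ∈ S, κ * ‖y - y'‖ ^ 2 ≤ 1 / 8) {ι : Type*} [Fintype ι]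
    (ρ : ι → Measure ℂ) [∀ i, IsProbabilityMeasure (ρ i)] (hρ : ∀ i, ∀ᵐ y ∂ρ i, y ∈ S) :
    ConvexTau (Measure.pi ρ) (fun x => κ * ∑ i, ‖x i‖ ^ 2) := by
  revert ρ
  refine Fintype.induction_empty_option (P := fun ι [Fintype ι] => ∀ (ρ : ι → Measure ℂ)
    [∀ i, IsProbabilityMeasure (ρ i)], (∀ i, ∀ᵐ y ∂ρ i, y ∈ S) →
      ConvexTau (Measure.pi ρ) (fun x => κ * ∑ i, ‖x i‖ ^ 2)) ?_ ?_ ?_ ι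
  · intro α β _ e ih ρ _ hρ
    let := Fintype.ofEquiv β e.symm
    have h := ih (fun i => ρ (e i)) (fun i => hρ (e i))
    let L : (α → ℂ) →L[ℝ] (β → ℂ) :=
      ContinuousLinearMap.pi fun i => ContinuousLinearMap.proj (e.symm i)
    have hL : ⇑L = ⇑(MeasurableEquiv.piCongrLeft (fun _ : β => ℂ) e) := by
      ext x i
      obtain ⟨j, rfl⟩ := e.surjective i
      simp [L, MeasurableEquiv.coe_piCongrLeft]
    refine h.map L ?_ ?_ ?_ fun x => ?_
    · rw [hL]; exact MeasurableEquiv.surjective _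
    · rw [hL]; exact MeasurableEquiv.measurableEmbedding _
    · rw [hL]; exact Measure.pi_map_piCongrLeft e ρ
    · congr 1
      exact e.symm.sum_comp fun i => ‖x i‖ ^ 2
  · intro ρ _ hρ
    exact ConvexTau.of_subsingleton _ (by simp)
  · intro α _ ih ρ _ hρ
    have h := ConvexTau.prod (c := fun x : α → ℂ => κ * ∑ i, ‖x i‖ ^ 2) (fun x => by positivity)
      ?_ (by fun_prop) (ih (fun i => ρ (some i)) fun i => hρ _) hS (hρ none) hκ hκS
    · let L : (ℂ × (α → ℂ)) →L[ℝ] (Option α → ℂ) :=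
        ContinuousLinearMap.pi fun i => i.elim (ContinuousLinearMap.fst ℝ ℂ (α → ℂ))
          fun j => (ContinuousLinearMap.proj j).comp (ContinuousLinearMap.snd ℝ ℂ (α → ℂ))
      have hL : ⇑L = ⇑((MeasurableEquiv.prodComm).trans
          (MeasurableEquiv.piOptionEquivProd (fun _ : Option α => ℂ)).symm) := by
        ext x i
        cases i <;> rfl
      refine h.map L ?_ ?_ ?_ fun x => ?_
      · rw [hL]; exact MeasurableEquiv.surjective _
      · rw [hL]; exact MeasurableEquiv.measurableEmbedding _
      · rw [hL, MeasurableEquiv.coe_trans, ← Measure.map_map (MeasurableEquiv.measurable _)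
          (MeasurableEquiv.measurable _), ← Measure.pi_map_piOptionEquivProd ρ]
        congr 1
        exact Measure.prod_swap
      · rw [Fintype.sum_option, mul_add]
        rfl
    · refine ⟨convex_univ, fun x _ y _ s r hs hr hsr => ?_⟩
      have key : ∀ i, ‖(s • x + r • y) i‖ ^ 2 ≤ s * ‖x i‖ ^ 2 + r * ‖y i‖ ^ 2 := fun i => by
        have h1 := (convexOn_univ_norm (E := ℂ)).pow (fun _ _ => norm_nonneg _) 2
        exact h1.2 (Set.mem_univ (x i)) (Set.mem_univ (y i)) hs hr hsr
      have := mul_le_mul_of_nonneg_left (Finset.sum_le_sum fun i (_ : i ∈ Finset.univ) => key i) hκ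
      refine this.trans (le_of_eq ?_)
      simp only [Finset.sum_add_distrib, ← Finset.mul_sum, smul_eq_mul]
      ring

end HeavyWigner

/-! ### Concentration of convex Lipschitz functions of bounded independent variables -/

namespace HeavyWigner

section Concentration

variable {κ : ℝ} {S : Set ℂ} {ι : Type*} [Fintype ι] {ρ : ι → Measure ℂ}
  [∀ i, IsProbabilityMeasure (ρ i)] {A : ℝ}

lemma continuous_of_abs_sub_le_sqrt {F : (ι → ℂ) → ℝ}
    (hL : ∀ w w', |F w - F w'| ≤ √(A * ∑ i, ‖w i - w' i‖ ^ 2)) : Continuous F := by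
  rw [continuous_iff_continuousAt]
  intro w
  rw [ContinuousAt, tendsto_iff_dist_tendsto_zero]
  have h : Tendsto (fun w' : ι → ℂ => √(A * ∑ i, ‖w' i - w i‖ ^ 2)) (𝓝 w) (𝓝 0) := by
    have : Continuous fun w' : ι → ℂ => √(A * ∑ i, ‖w' i - w i‖ ^ 2) := by fun_prop
    simpa using this.tendsto w
  exact squeeze_zero (fun _ => dist_nonneg) (fun w' => hL w' w) h

/-- Apply the `τ`-property to `θF`: by the Lipschitz bound and completing the square, the infimum
convolution loses at most `θ²A/(4κ)` from `θF`. -/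
lemma lintegral_exp_mul_lintegral_exp_neg_le (hκ : 0 < κ) (hS : IsCompact S)
    (hκS : ∀ y ∈ S, ∀ y' ∈ S, κ * ‖y - y'‖ ^ 2 ≤ 1 / 8) (hρ : ∀ i, ∀ᵐ y ∂ρ i, y ∈ S)
    (hA : 0 ≤ A) {F : (ι → ℂ) → ℝ} (hF : ConvexOn ℝ Set.univ F)
    (hL : ∀ w w', |F w - F w'| ≤ √(A * ∑ i, ‖w i - w' i‖ ^ 2)) {θ : ℝ} (hθ : 0 ≤ θ) :
    (∫⁻ w, ENNReal.ofReal (Real.exp (θ * F w)) ∂Measure.pi ρ) *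
      (∫⁻ w, ENNReal.ofReal (Real.exp (-(θ * F w))) ∂Measure.pi ρ) ≤
      ENNReal.ofReal (Real.exp (θ ^ 2 * A / (4 * κ))) := by
  have hFc := continuous_of_abs_sub_le_sqrt hL
  -- `ConvexTau` needs a function bounded below. Taking the maximum with `b` preserves convexity and
  -- changes nothing on the support.
  obtain ⟨b, hb⟩ := (isCompact_univ_pi fun _ : ι => hS).bddBelow_image
    (f := fun w => θ * F w) (by fun_prop)
  have hae : ∀ᵐ w ∂Measure.pi ρ, max (θ * F w) b = θ * F w := by
    have h1 : ∀ᵐ w ∂Measure.pi ρ, ∀ i, w i ∈ S :=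
      ae_all_iff.2 fun i => Measure.tendsto_eval_ae_ae.eventually (hρ i)
    filter_upwards [h1] with w hw
    exact max_eq_left (hb ⟨w, fun i _ => hw i, rfl⟩)
  have hbb : BddBelow (Set.range fun w => max (θ * F w) b) :=
    ⟨b, by rintro _ ⟨w, rfl⟩; exact le_max_right _ _⟩
  have hconv : ConvexOn ℝ Set.univ fun w => max (θ * F w) b :=
    (hF.smul hθ).sup (convexOn_const b convex_univ)
  have hT := convexTau_pi hκ.le hS hκS ρ hρ (fun w => max (θ * F w) b) hconv (by fun_prop) hbb
  have hQ : ∀ w, θ * F w - θ ^ 2 * A / (4 * κ) ≤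
      infConv (fun x : ι → ℂ => κ * ∑ i, ‖x i‖ ^ 2) (fun w => max (θ * F w) b) w := by
    intro w
    refine le_ciInf fun y => ?_
    have h1 := (abs_le.1 (hL w y)).2
    have h2 := le_max_left (θ * F y) b
    have h0 : 0 ≤ ∑ i, ‖w i - y i‖ ^ 2 := by positivity
    have h3 := mul_le_mul_of_nonneg_left h1 hθ
    have h4 : √(A * ∑ i, ‖w i - y i‖ ^ 2) ^ 2 = A * ∑ i, ‖w i - y i‖ ^ 2 :=
      Real.sq_sqrt (by positivity)
    rw [Real.sqrt_mul hA] at h3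
    have h5 := Real.sq_sqrt hA
    have h6 := Real.sq_sqrt h0
    have h7 : θ * (√A * √(∑ i, ‖w i - y i‖ ^ 2)) ≤
        θ ^ 2 * A / (4 * κ) + κ * ∑ i, ‖w i - y i‖ ^ 2 := by
      obtain ⟨u, hu⟩ : ∃ u, u = √(∑ i, ‖w i - y i‖ ^ 2) := ⟨_, rfl⟩
      obtain ⟨v, hv⟩ : ∃ v, v = √A := ⟨_, rfl⟩
      rw [← hu] at h6 ⊢
      rw [← hv] at h5 ⊢
      rw [← h6, ← h5]
      rw [← sub_nonneg]
      have : θ ^ 2 * v ^ 2 / (4 * κ) + κ * u ^ 2 - θ * (v * u)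
          = (θ * v - 2 * κ * u) ^ 2 / (4 * κ) := by
        field_simp
        ring
      rw [this]
      positivity
    simp only [Pi.sub_apply]
    linarith
  rw [lintegral_congr_ae (f := fun w => ENNReal.ofReal (Real.exp (-max (θ * F w) b)))
    (g := fun w => ENNReal.ofReal (Real.exp (-(θ * F w))))
    (hae.mono fun w hw => by simp only [hw])] at hT
  have h1 : ∫⁻ w, ENNReal.ofReal (Real.exp (θ * F w)) ∂Measure.pi ρ ≤
      ENNReal.ofReal (Real.exp (θ ^ 2 * A / (4 * κ))) *
      ∫⁻ w, ENNReal.ofReal (Real.exp (infConv (fun x : ι → ℂ => κ * ∑ i, ‖x i‖ ^ 2)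
        (fun w => max (θ * F w) b) w)) ∂Measure.pi ρ := by
    rw [← lintegral_const_mul' _ _ ENNReal.ofReal_ne_top]
    refine lintegral_mono fun w => ?_
    rw [← ENNReal.ofReal_mul (Real.exp_pos _).le, ← Real.exp_add]
    exact ENNReal.ofReal_le_ofReal (Real.exp_le_exp.2 (by linarith [hQ w]))
  refine (mul_le_mul_left h1 _).trans ?_
  rw [mul_assoc]
  exact (mul_le_mul_right hT _).trans (by rw [mul_one])

/-- Concentration of convex Lipschitz functions depending on a parameter `c` around a measurable
function of `c`. -/
theorem exists_measurable_concentration (hκ : 0 < κ) (hS : IsCompact S)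
    (hκS : ∀ y ∈ S, ∀ y' ∈ S, κ * ‖y - y'‖ ^ 2 ≤ 1 / 8) (hρ : ∀ i, ∀ᵐ y ∂ρ i, y ∈ S)
    (hA : 0 < A) {Y : Type*} [MeasurableSpace Y] {F : (ι → ℂ) → Y → ℝ}
    (hFm : Measurable (Function.uncurry F)) (hF : ∀ c, ConvexOn ℝ Set.univ fun w => F w c)
    (hL : ∀ c w w', |F w c - F w' c| ≤ √(A * ∑ i, ‖w i - w' i‖ ^ 2)) {s : ℝ} (hs : 0 < s) :
    ∃ m : Y → ℝ, Measurable m ∧ ∀ c, Measure.pi ρ {w | s < |F w c - m c|} ≤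
      ENNReal.ofReal (2 * Real.exp (-(κ * s ^ 2 / A))) := by
  -- This minimizes `θ²A/(4κ) - θs`, with value `-κs²/A`.
  set θ : ℝ := 2 * κ * s / A with hθdef
  have hθ : 0 < θ := by positivity
  set I : Y → ENNReal := fun c => ∫⁻ w, ENNReal.ofReal (Real.exp (θ * F w c)) ∂Measure.pi ρ
    with hI
  have hIm : Measurable I := by
    refine Measurable.lintegral_prod_left' (f := fun p : (ι → ℂ) × Y =>
      ENNReal.ofReal (Real.exp (θ * F p.1 p.2))) ?_
    exact (Real.measurable_exp.comp (hFm.const_mul θ)).ennreal_ofReal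
  have hKs : θ ^ 2 * A / (4 * κ) = κ * s ^ 2 / A := by
    rw [hθdef]; field_simp; ring
  have hθs : θ * s = 2 * (κ * s ^ 2 / A) := by
    rw [hθdef]; field_simp
  -- Centring at the normalized log-Laplace transform, rather than at a median, makes measurability
  -- in `c` immediate. Markov's inequality for `exp(θF)` gives the upper tail; the product bound
  -- controls `exp(-θF)` for the lower one.
  refine ⟨fun c => Real.log (I c).toReal / θ,
    (Real.measurable_log.comp hIm.ennreal_toReal).div_const θ, fun c => ?_⟩
  have hFcm : Measurable fun w => F w c := (continuous_of_abs_sub_le_sqrt (hL c)).measurable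
  set J : ENNReal := ∫⁻ w, ENNReal.ofReal (Real.exp (-(θ * F w c))) ∂Measure.pi ρ with hJ
  have hIJ : I c * J ≤ ENNReal.ofReal (Real.exp (κ * s ^ 2 / A)) := by
    rw [← hKs]
    exact lintegral_exp_mul_lintegral_exp_neg_le hκ hS hκS hρ hA.le (hF c) (hL c) hθ.le
  have hpos : ∀ g : (ι → ℂ) → ℝ, Measurable g →
      ∫⁻ w, ENNReal.ofReal (Real.exp (g w)) ∂Measure.pi ρ ≠ 0 := by
    intro g hg h
    rw [lintegral_eq_zero_iff hg.exp.ennreal_ofReal] at h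
    obtain ⟨w, hw⟩ := h.exists
    simp only [Pi.zero_apply, ENNReal.ofReal_eq_zero] at hw
    exact absurd hw (not_le.2 (Real.exp_pos _))
  have hI0 : I c ≠ 0 := hpos _ (hFcm.const_mul θ)
  have hJ0 : J ≠ 0 := hpos _ (hFcm.const_mul θ).neg
  have hItop : I c ≠ ⊤ := by
    intro h
    rw [h, ENNReal.top_mul hJ0] at hIJ
    exact ENNReal.ofReal_ne_top (top_le_iff.1 hIJ)
  set m : ℝ := Real.log (I c).toReal / θ with hm
  have hIm' : I c = ENNReal.ofReal (Real.exp (θ * m)) := by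
    rw [hm, mul_div_cancel₀ _ hθ.ne', Real.exp_log (ENNReal.toReal_pos hI0 hItop),
      ENNReal.ofReal_toReal hItop]
  have cancel : ∀ (P : ENNReal) (x y : ℝ), ENNReal.ofReal (Real.exp x) * P ≤
      ENNReal.ofReal (Real.exp y) → P ≤ ENNReal.ofReal (Real.exp (y - x)) := by
    intro P x y h
    have h' := mul_le_mul_right h (ENNReal.ofReal (Real.exp (-x)))
    rwa [← mul_assoc, ← ENNReal.ofReal_mul (Real.exp_pos _).le,
      ← ENNReal.ofReal_mul (Real.exp_pos _).le, ← Real.exp_add, ← Real.exp_add, neg_add_cancel,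
      Real.exp_zero, ENNReal.ofReal_one, one_mul, neg_add_eq_sub] at h'
  have hup : Measure.pi ρ {w | s < F w c - m} ≤ ENNReal.ofReal (Real.exp (-(κ * s ^ 2 / A))) := by
    have h1 := mul_meas_ge_le_lintegral (μ := Measure.pi ρ)
      (f := fun w => ENNReal.ofReal (Real.exp (θ * F w c)))
      (Real.measurable_exp.comp (hFcm.const_mul θ)).ennreal_ofReal
      (ENNReal.ofReal (Real.exp (θ * (s + m))))
    change _ ≤ I c at h1
    rw [hIm'] at h1
    refine (measure_mono fun w hw => ?_).trans ((cancel _ _ _ h1).trans ?_)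
    · refine ENNReal.ofReal_le_ofReal (Real.exp_le_exp.2 (mul_le_mul_of_nonneg_left ?_ hθ.le))
      have : s < F w c - m := hw
      linarith
    · refine ENNReal.ofReal_le_ofReal (Real.exp_le_exp.2 ?_)
      have : 0 ≤ κ * s ^ 2 / A := by positivity
      nlinarith
  have hlow : Measure.pi ρ {w | s < m - F w c} ≤
      ENNReal.ofReal (Real.exp (-(κ * s ^ 2 / A))) := by
    have h1 := mul_meas_ge_le_lintegral (μ := Measure.pi ρ)
      (f := fun w => ENNReal.ofReal (Real.exp (-(θ * F w c))))
      (Real.measurable_exp.comp (hFcm.const_mul θ).neg).ennreal_ofReal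
      (ENNReal.ofReal (Real.exp (θ * (s - m))))
    have h2 : J ≤ ENNReal.ofReal (Real.exp (κ * s ^ 2 / A - θ * m)) := by
      rw [hIm'] at hIJ
      exact cancel _ _ _ hIJ
    refine (measure_mono fun w hw => ?_).trans ((cancel _ _ _ (h1.trans h2)).trans ?_)
    · refine ENNReal.ofReal_le_ofReal (Real.exp_le_exp.2 ?_)
      have : s < m - F w c := hw
      nlinarith
    · refine ENNReal.ofReal_le_ofReal (Real.exp_le_exp.2 ?_)
      nlinarith
  have hsub : {w | s < |F w c - m|} ⊆ {w | s < F w c - m} ∪ {w | s < m - F w c} := by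
    intro w hw
    rcases lt_abs.1 (show s < |F w c - m| from hw) with h | h
    · exact Or.inl h
    · exact Or.inr (by simpa using h)
  refine (measure_mono hsub).trans ((measure_union_le _ _).trans ((add_le_add hup hlow).trans ?_))
  rw [← ENNReal.ofReal_add (Real.exp_pos _).le (Real.exp_pos _).le, two_mul]

end Concentration

end HeavyWigner

/-! ### Stretched exponential moments and the weight of the discarded entries -/

namespace HeavyWigner

variable {Ω : Type*} [MeasurableSpace Ω]

lemma supAbs_nonneg (z : ℂ) : 0 ≤ supAbs z := (abs_nonneg _).trans (le_max_left _ _)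

lemma supAbs_le_norm (z : ℂ) : supAbs z ≤ ‖z‖ :=
  max_le (Complex.abs_re_le_norm z) (Complex.abs_im_le_norm z)

lemma norm_sq_le_two_mul_supAbs_sq (z : ℂ) : ‖z‖ ^ 2 ≤ 2 * supAbs z ^ 2 := by
  rw [Complex.sq_norm, Complex.normSq_apply]
  have h1 : |z.re| ^ 2 ≤ supAbs z ^ 2 := by gcongr; exact le_max_left _ _
  have h2 : |z.im| ^ 2 ≤ supAbs z ^ 2 := by gcongr; exact le_max_right _ _
  rw [sq_abs] at h1 h2
  nlinarith

lemma continuous_supAbs : Continuous supAbs :=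
  Complex.continuous_re.abs.max Complex.continuous_im.abs

lemma supAbs_star (z : ℂ) : supAbs (star z) = supAbs z := by
  simp [supAbs]

/-- Variables with a stretched exponential tail have a stretched exponential moment. -/
lemma HasTail.exists_lintegral_exp_lt_top {μ : Measure Ω} [IsProbabilityMeasure μ] {α c : ℝ}
    {Y : Ω → ℂ} (hY : Measurable Y) (hα : 0 < α) (hc : 0 < c) (h : HasTail μ α c Y) :
    ∃ η₀ : ℝ, 0 < η₀ ∧ ∀ η ≤ η₀, ∫⁻ ω, ENNReal.ofReal (Real.exp (η * ‖Y ω‖ ^ α)) ∂μ ≠ ⊤ := by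
  -- For large `t` the tail is at most `exp(-(c/2) t^α)`, twice the rate `η`, so the sum over
  -- integer levels of `‖Y‖^α` converges geometrically.
  set η : ℝ := c / 4 with hη
  have hηpos : 0 < η := by positivity
  have htail : ∀ᶠ t : ℝ in atTop, μ.real {ω | t < ‖Y ω‖} ≤ Real.exp (-(2 * η * t ^ α)) := by
    filter_upwards [h.eventually (lt_mem_nhds (half_lt_self hc)), eventually_gt_atTop 0]
      with t ht ht0
    rcases (measureReal_nonneg (μ := μ) (s := {ω | t < ‖Y ω‖})).eq_or_lt with h0 | h0
    · rw [← h0]; positivity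
    · rw [← Real.log_le_iff_le_exp h0]
      rw [Real.rpow_neg ht0.le] at ht
      have hp : 0 < t ^ α := Real.rpow_pos_of_pos ht0 _
      have h1 := mul_lt_mul_of_pos_right ht hp
      have h2 : -(t ^ α)⁻¹ * Real.log (μ.real {ω | t < ‖Y ω‖}) * t ^ α
          = -Real.log (μ.real {ω | t < ‖Y ω‖}) := by field_simp
      rw [h2] at h1
      rw [hη]
      linarith
  have hnat : ∀ᶠ n : ℕ in atTop, μ {ω | (n : ℝ) < ‖Y ω‖ ^ α} ≤
      ENNReal.ofReal (Real.exp (-(2 * η * n))) := by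
    have hlim : Tendsto (fun n : ℕ => (n : ℝ) ^ (1 / α)) atTop atTop :=
      (tendsto_rpow_atTop (by positivity)).comp tendsto_natCast_atTop_atTop
    filter_upwards [hlim.eventually htail] with n hn
    have e : ((n : ℝ) ^ (1 / α)) ^ α = n := by
      rw [← Real.rpow_mul n.cast_nonneg, one_div_mul_cancel hα.ne', Real.rpow_one]
    rw [e] at hn
    have hset : {ω | (n : ℝ) < ‖Y ω‖ ^ α} ⊆ {ω | (n : ℝ) ^ (1 / α) < ‖Y ω‖} := by
      intro ω hω
      have hω' : (n : ℝ) < ‖Y ω‖ ^ α := hω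
      rw [← e] at hω'
      exact (Real.rpow_lt_rpow_iff (by positivity) (norm_nonneg _) hα).1 hω'
    refine (measure_mono hset).trans ?_
    rw [← ofReal_measureReal]
    exact ENNReal.ofReal_le_ofReal hn
  obtain ⟨n₀, hn₀⟩ := eventually_atTop.1 hnat
  have hmain : ∫⁻ ω, ENNReal.ofReal (Real.exp (η * ‖Y ω‖ ^ α)) ∂μ ≠ ⊤ := by
    set S : ℕ → Set Ω := fun n => {ω | ((n + n₀ : ℕ) : ℝ) < ‖Y ω‖ ^ α} with hS
    have hSm : ∀ n, MeasurableSet (S n) := fun n =>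
      measurableSet_lt measurable_const (hY.norm.pow_const α)
    have hpt : ∀ ω, ENNReal.ofReal (Real.exp (η * ‖Y ω‖ ^ α)) ≤
        ENNReal.ofReal (Real.exp (η * (n₀ + 1))) + ∑' n : ℕ, (S n).indicator
          (fun _ => ENNReal.ofReal (Real.exp (η * ((n + n₀ : ℕ) + 1)))) ω := by
      intro ω
      by_cases hω : ‖Y ω‖ ^ α ≤ n₀ + 1
      · refine le_add_right (ENNReal.ofReal_le_ofReal (Real.exp_le_exp.2 ?_))
        exact mul_le_mul_of_nonneg_left hω hηpos.le
      · push Not at hω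
        refine le_add_left ?_
        obtain ⟨k, hk⟩ : ∃ k, ⌈‖Y ω‖ ^ α⌉₊ = (k + n₀) + 1 := by
          have : n₀ + 1 < ⌈‖Y ω‖ ^ α⌉₊ := by
            rw [Nat.lt_ceil]; push_cast; exact hω
          exact ⟨⌈‖Y ω‖ ^ α⌉₊ - n₀ - 1, by omega⟩
        have h1 : ω ∈ S k := by
          have : k + n₀ < ⌈‖Y ω‖ ^ α⌉₊ := by omega
          exact Nat.lt_ceil.1 this
        have h2 : ‖Y ω‖ ^ α ≤ ((k + n₀ : ℕ) : ℝ) + 1 := by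
          have := Nat.le_ceil (‖Y ω‖ ^ α)
          rw [hk] at this
          exact_mod_cast this
        refine le_trans ?_ (ENNReal.le_tsum k)
        rw [Set.indicator_of_mem h1]
        exact ENNReal.ofReal_le_ofReal (Real.exp_le_exp.2 (mul_le_mul_of_nonneg_left h2 hηpos.le))
    refine ne_top_of_le_ne_top ?_ (lintegral_mono hpt)
    rw [lintegral_add_left measurable_const, lintegral_tsum fun n =>
      (measurable_const.indicator (hSm n)).aemeasurable, lintegral_const, measure_univ, mul_one]
    refine ENNReal.add_ne_top.2 ⟨ENNReal.ofReal_ne_top, ?_⟩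
    have hsum : Summable fun n : ℕ => Real.exp η * Real.exp (-η * (n + n₀ : ℕ)) := by
      refine Summable.mul_left _ ?_
      refine (summable_nat_add_iff (f := fun n : ℕ => Real.exp (-η * n)) n₀).2 ?_
      have := Real.summable_exp_nat_mul_iff.2 (neg_neg_of_pos hηpos)
      simpa only [mul_comm] using this
    refine ne_top_of_le_ne_top hsum.tsum_ofReal_ne_top (ENNReal.tsum_le_tsum fun n => ?_)
    rw [lintegral_indicator_const (hSm n)]
    refine (mul_le_mul_right (hn₀ (n + n₀) (by omega)) _).trans ?_
    rw [← ENNReal.ofReal_mul (Real.exp_pos _).le, ← Real.exp_add, ← Real.exp_add]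
    refine ENNReal.ofReal_le_ofReal (Real.exp_le_exp.2 (le_of_eq ?_))
    ring
  refine ⟨η, hηpos, fun η' hη' => ne_top_of_le_ne_top hmain (lintegral_mono fun ω => ?_)⟩
  exact ENNReal.ofReal_le_ofReal (Real.exp_le_exp.2 (mul_le_mul_of_nonneg_right hη'
    (by positivity)))

/-- The exponential Chebyshev bound for a sum of functions of independent variables. -/
lemma measure_lt_sum_le {μ : Measure Ω} {ι : Type*} [Fintype ι] {x : ι → Ω → ℂ}
    (hx : ∀ i, Measurable (x i)) (hind : iIndepFun x μ) {g : ℂ → ℝ} (hg : Measurable g)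
    {θ q : ℝ} (hθ : 0 ≤ θ) (hq : 0 ≤ q) (hcard : (Fintype.card ι : ℝ) * q ≤ 1)
    (hmom : ∀ i, ∫⁻ ω, ENNReal.ofReal (Real.exp (θ * g (x i ω))) ∂μ ≤ ENNReal.ofReal (1 + q))
    (δ : ℝ) :
    μ {ω | δ < ∑ i, g (x i ω)} ≤ ENNReal.ofReal (Real.exp (1 - θ * δ)) := by
  have hme : ∀ i, Measurable fun ω => ENNReal.ofReal (Real.exp (θ * g (x i ω))) := fun i =>
    ((hg.comp (hx i)).const_mul θ).exp.ennreal_ofReal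
  have hprod : ∫⁻ ω, ENNReal.ofReal (Real.exp (θ * ∑ i, g (x i ω))) ∂μ ≤
      ENNReal.ofReal (Real.exp 1) := by
    have e : ∀ ω, ENNReal.ofReal (Real.exp (θ * ∑ i, g (x i ω))) =
        ∏ i, ENNReal.ofReal (Real.exp (θ * g (x i ω))) := fun ω => by
      rw [Finset.mul_sum, Real.exp_sum, ENNReal.ofReal_prod_of_nonneg]
      exact fun i _ => (Real.exp_pos _).le
    simp only [e]
    have hind' := hind.comp (fun _ z => ENNReal.ofReal (Real.exp (θ * g z)))
      (fun _ => (hg.const_mul θ).exp.ennreal_ofReal)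
    rw [lintegral_prod_eq_prod_lintegral_of_indepFun Finset.univ
      (fun i ω => ENNReal.ofReal (Real.exp (θ * g (x i ω)))) hind' hme]
    refine (Finset.prod_le_prod' fun i _ => hmom i).trans ?_
    rw [Finset.prod_const, Finset.card_univ, ← ENNReal.ofReal_pow (by positivity)]
    refine ENNReal.ofReal_le_ofReal ?_
    have h1 : 1 + q ≤ Real.exp q := by linarith [Real.add_one_le_exp q]
    refine (pow_le_pow_left₀ (by positivity) h1 _).trans ?_
    rw [← Real.exp_nat_mul]
    exact Real.exp_le_exp.2 hcard
  have h1 := mul_meas_ge_le_lintegral (μ := μ)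
    (f := fun ω => ENNReal.ofReal (Real.exp (θ * ∑ i, g (x i ω))))
    ((Finset.measurable_sum _ fun i _ => hg.comp (hx i)).const_mul θ).exp.ennreal_ofReal
    (ENNReal.ofReal (Real.exp (θ * δ)))
  have h2 := mul_le_mul_right (h1.trans hprod) (ENNReal.ofReal (Real.exp (-(θ * δ))))
  rw [← mul_assoc, ← ENNReal.ofReal_mul (Real.exp_pos _).le,
    ← ENNReal.ofReal_mul (Real.exp_pos _).le, ← Real.exp_add, ← Real.exp_add, neg_add_cancel,
    Real.exp_zero, ENNReal.ofReal_one, one_mul, neg_add_eq_sub] at h2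
  refine (measure_mono fun ω hω => ?_).trans h2
  exact ENNReal.ofReal_le_ofReal (Real.exp_le_exp.2
    (mul_le_mul_of_nonneg_left (le_of_lt hω) hθ))

/-- The contribution to the error of an entry of size `s`, for truncation at `L`, `ε * r` and
`ε⁻¹ * r`, where `r = √N`. -/
noncomputable def errorWeight (L ε r s : ℝ) : ℝ :=
  if s ≤ L then 0
  else L ^ 2 / r ^ 2 + (if s < ε * r then s ^ 2 / r ^ 2 else 0) + if ε⁻¹ * r < s then 1 else 0

lemma measurable_errorWeight (L ε r : ℝ) : Measurable (errorWeight L ε r) := by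
  unfold errorWeight
  refine Measurable.ite measurableSet_Iic measurable_const ?_
  refine Measurable.add (Measurable.add measurable_const ?_) ?_
  · exact Measurable.ite measurableSet_Iio (by fun_prop) measurable_const
  · exact Measurable.ite measurableSet_Ioi measurable_const measurable_const

lemma errorWeight_nonneg (L ε r s : ℝ) : 0 ≤ errorWeight L ε r s := by
  unfold errorWeight
  split_ifs <;> positivity

/-- For `s < εr`, `r^α s²/r² = (s/r)^(2-α) s^α ≤ ε^(2-α) s^α`. For `s > r/ε`, `r^α ≤ ε^α s^α`. So
both kinds of discarded entries cost a small multiple of `s^α`. -/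
lemma mul_errorWeight_le {α K κ L ε r s : ℝ} (hα : 0 < α) (hα2 : α < 2) (hK : 0 ≤ K) (hL : 0 ≤ L)
    (hε : 0 < ε) (hr : 0 < r) (hεK : K * ε ^ (2 - α) + K * ε ^ α ≤ κ)
    (hLr : K * r ^ α * (L ^ 2 / r ^ 2) ≤ 1) (hs : L < s) :
    K * r ^ α * errorWeight L ε r s ≤ 1 + κ * s ^ α := by
  have hs0 : 0 < s := hL.trans_lt hs
  have hsα : 0 < s ^ α := Real.rpow_pos_of_pos hs0 _
  have hrα : 0 < r ^ α := Real.rpow_pos_of_pos hr _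
  have h1 : r ^ α * (if s < ε * r then s ^ 2 / r ^ 2 else 0) ≤ ε ^ (2 - α) * s ^ α := by
    split_ifs with h
    · have e1 : r ^ α * (s ^ 2 / r ^ 2) = (s / r) ^ (2 - α) * s ^ α := by
        rw [Real.rpow_sub (div_pos hs0 hr), Real.div_rpow hs0.le hr.le α, Real.rpow_two]
        field_simp
      rw [e1]
      have h2 : s / r ≤ ε := (div_le_iff₀ hr).2 h.le
      gcongr
    · rw [mul_zero]; positivity
  have h2 : r ^ α * (if ε⁻¹ * r < s then 1 else 0) ≤ ε ^ α * s ^ α := by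
    split_ifs with h
    · rw [mul_one, ← Real.mul_rpow hε.le hs0.le]
      have : r ≤ ε * s := by
        rw [inv_mul_lt_iff₀ hε] at h
        exact h.le
      gcongr
    · rw [mul_zero]; positivity
  rw [errorWeight, if_neg (not_le.2 hs)]
  have h3 := mul_le_mul_of_nonneg_left h1 hK
  have h4 := mul_le_mul_of_nonneg_left h2 hK
  have h5 := mul_le_mul_of_nonneg_right hεK hsα.le
  nlinarith

/-- Entries below `L` contribute exactly `1`. Above `L`, half of the moment of order `2κ` dominates
the weight and the other half yields the factor `exp(-κ L^α)`. -/
lemma lintegral_exp_errorWeight_le {μ : Measure Ω} [IsProbabilityMeasure μ] {Y : Ω → ℂ}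
    {α K κ L ε r M : ℝ} (hα : 0 < α) (hα2 : α < 2) (hK : 0 ≤ K) (hκ : 0 ≤ κ) (hL : 0 ≤ L)
    (hε : 0 < ε) (hr : 0 < r) (hεK : K * ε ^ (2 - α) + K * ε ^ α ≤ κ)
    (hLr : K * r ^ α * (L ^ 2 / r ^ 2) ≤ 1) (hM : 0 ≤ M)
    (hY : ∫⁻ ω, ENNReal.ofReal (Real.exp (2 * κ * ‖Y ω‖ ^ α)) ∂μ ≤ ENNReal.ofReal M) :
    ∫⁻ ω, ENNReal.ofReal (Real.exp (K * r ^ α * errorWeight L ε r (supAbs (Y ω)))) ∂μ ≤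
      ENNReal.ofReal (1 + Real.exp (1 - κ * L ^ α) * M) := by
  have hpt : ∀ ω, ENNReal.ofReal (Real.exp (K * r ^ α * errorWeight L ε r (supAbs (Y ω)))) ≤
      1 + ENNReal.ofReal (Real.exp (1 - κ * L ^ α)) *
        ENNReal.ofReal (Real.exp (2 * κ * ‖Y ω‖ ^ α)) := by
    intro ω
    by_cases hs : supAbs (Y ω) ≤ L
    · rw [errorWeight, if_pos hs]
      simp
    · push Not at hs
      refine le_add_left ?_
      rw [← ENNReal.ofReal_mul (Real.exp_pos _).le, ← Real.exp_add]
      refine ENNReal.ofReal_le_ofReal (Real.exp_le_exp.2 ?_)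
      refine (mul_errorWeight_le hα hα2 hK hL hε hr hεK hLr hs).trans ?_
      have h1 : L ^ α ≤ supAbs (Y ω) ^ α := Real.rpow_le_rpow hL hs.le hα.le
      have h2 : supAbs (Y ω) ^ α ≤ ‖Y ω‖ ^ α :=
        Real.rpow_le_rpow (supAbs_nonneg _) (supAbs_le_norm _) hα.le
      nlinarith [mul_le_mul_of_nonneg_left h1 hκ, mul_le_mul_of_nonneg_left h2 hκ]
  refine (lintegral_mono hpt).trans ?_
  rw [lintegral_add_left measurable_const, lintegral_const, measure_univ, mul_one,
    lintegral_const_mul' _ _ ENNReal.ofReal_ne_top,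
    ENNReal.ofReal_add zero_le_one (by positivity), ENNReal.ofReal_one,
    ENNReal.ofReal_mul (Real.exp_pos _).le]
  gcongr

open Classical in
/-- The entrywise function whose value at an entry of `M` is the corresponding entry of
`largePart ε M`, where `r = √N`. -/
noncomputable def largeEntry (ε r : ℝ) (z : ℂ) : ℂ :=
  if ε * r ≤ supAbs z ∧ supAbs z ≤ ε⁻¹ * r then z / (r : ℂ) else 0

open Classical in
/-- Replacement of the value `z` by `h` when `z` is above the truncation level. -/
noncomputable def resample (L : ℝ) (z h : ℂ) : ℂ := if supAbs z ≤ L then z else h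

open Classical in
/-- The value `z` if it is above the truncation level, `0` otherwise. -/
noncomputable def overflow (L : ℝ) (z : ℂ) : ℂ := if supAbs z ≤ L then 0 else z

/-- This makes `C^ε` a function of the overflow alone, so that it can be frozen while the small
entries fluctuate. -/
lemma largeEntry_overflow {L ε r : ℝ} (hL : 0 ≤ L) (h : L < ε * r) (z : ℂ) :
    largeEntry ε r (overflow L z) = largeEntry ε r z := by
  unfold overflow
  split_ifs with hz
  · have h1 : ¬ (ε * r ≤ supAbs 0) := by
      simp only [supAbs, Complex.zero_re, Complex.zero_im, abs_zero, max_self]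
      linarith
    have h2 : ¬ (ε * r ≤ supAbs z) := by linarith
    simp [largeEntry, h1, h2]
  · rfl

/-- A weight below `1` excludes `supAbs z > ε⁻¹ r`. In the window kept by `largeEntry` the
difference is `-h / r`. Between `L` and `ε r` it is `(z - h) / r`, and `4` comes from `‖z - h‖² ≤
2‖z‖² + 2‖h‖²` with `‖·‖² ≤ 2 supAbs²`. -/
lemma norm_sub_resample_sq_le {L ε r : ℝ} (hr : 0 < r) (hLε : L < ε * r) {z h : ℂ}
    (hh : supAbs h ≤ L) (hlt : errorWeight L ε r (supAbs z) < 1) :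
    ‖z / (r : ℂ) - (resample L z h / (r : ℂ) + largeEntry ε r z)‖ ^ 2 ≤
      4 * errorWeight L ε r (supAbs z) := by
  have hh2 : ‖h‖ ^ 2 ≤ 2 * L ^ 2 := (norm_sq_le_two_mul_supAbs_sq h).trans
    (by have := pow_le_pow_left₀ (supAbs_nonneg h) hh 2; linarith)
  have hz2 := norm_sq_le_two_mul_supAbs_sq z
  unfold errorWeight at hlt ⊢
  unfold resample
  by_cases hzL : supAbs z ≤ L
  · have h2 : ¬ (ε * r ≤ supAbs z) := by linarith
    simp [largeEntry, h2, hzL]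
  · simp only [hzL, if_false] at hlt ⊢
    by_cases h3 : ε⁻¹ * r < supAbs z
    · exfalso
      rw [if_pos h3] at hlt
      have : 0 ≤ L ^ 2 / r ^ 2 + (if supAbs z < ε * r then supAbs z ^ 2 / r ^ 2 else 0) := by
        split_ifs <;> positivity
      linarith
    · simp only [h3, if_false, add_zero]
      by_cases h4 : supAbs z < ε * r
      · rw [if_pos h4, largeEntry, if_neg (by rintro ⟨h, _⟩; linarith), add_zero, ← sub_div,
          norm_div, div_pow, Complex.norm_real, Real.norm_eq_abs, abs_of_pos hr, ← add_div,
          mul_div_assoc']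
        gcongr
        have h5 := norm_sub_le z h
        have h6 : ‖z - h‖ ^ 2 ≤ (‖z‖ + ‖h‖) ^ 2 := by gcongr
        nlinarith [sq_nonneg (‖z‖ - ‖h‖)]
      · push Not at h3 h4
        rw [if_neg (not_lt.2 h4), largeEntry, if_pos ⟨h4, h3⟩, sub_add_cancel_right, norm_neg,
          norm_div, div_pow, Complex.norm_real, Real.norm_eq_abs, abs_of_pos hr, add_zero,
          mul_div_assoc']
        gcongr
        nlinarith [sq_nonneg L]

end HeavyWigner

/-! ### Resampling: decoupling the small entries from the large ones -/

namespace HeavyWigner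

variable {Ω : Type*} [MeasurableSpace Ω]

lemma measurableSet_supAbs_le (L : ℝ) : MeasurableSet {z : ℂ | supAbs z ≤ L} :=
  measurableSet_le continuous_supAbs.measurable measurable_const

lemma measurable_resample (L : ℝ) : Measurable fun p : ℂ × ℂ => resample L p.1 p.2 :=
  Measurable.ite (measurable_fst (measurableSet_supAbs_le L)) measurable_fst measurable_snd

lemma measurable_overflow (L : ℝ) : Measurable (overflow L) :=
  Measurable.ite (measurableSet_supAbs_le L) measurable_const measurable_id

lemma measurable_largeEntry (ε r : ℝ) : Measurable (largeEntry ε r) := by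
  refine Measurable.ite ?_ (by fun_prop) measurable_const
  exact (measurableSet_le measurable_const continuous_supAbs.measurable).inter
    (measurableSet_le continuous_supAbs.measurable measurable_const)

/-- Resampling the values below the truncation level makes them independent of those above. -/
lemma map_resample_overflow {L : ℝ} {ν ρ : Measure ℂ} [IsProbabilityMeasure ν]
    [IsProbabilityMeasure ρ] (h : ∀ U : Set ℂ, MeasurableSet U →
      ν ({z | supAbs z ≤ L} ∩ U) = ν {z | supAbs z ≤ L} * ρ U) :
    (ν.prod ρ).map (fun p => (resample L p.1 p.2, overflow L p.1)) = ρ.prod (ν.map (overflow L)) := by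
  have : IsProbabilityMeasure (ν.map (overflow L)) :=
    Measure.isProbabilityMeasure_map (measurable_overflow L).aemeasurable
  have hm : Measurable fun p : ℂ × ℂ => (resample L p.1 p.2, overflow L p.1) :=
    (measurable_resample L).prodMk ((measurable_overflow L).comp measurable_fst)
  symm
  refine Measure.prod_eq fun U V hU hV => ?_
  rw [Measure.map_apply hm (hU.prod hV), Measure.map_apply (measurable_overflow L) hV]
  set B : Set ℂ := {z | supAbs z ≤ L} with hB
  have hBm : MeasurableSet B := measurableSet_supAbs_le L
  have hVo : MeasurableSet (overflow L ⁻¹' V) := measurable_overflow L hV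
  rw [← measure_inter_add_sdiff _ (hBm.prod (MeasurableSet.univ (α := ℂ))),
    ← measure_inter_add_sdiff (overflow L ⁻¹' V) hBm]
  have e1 : (fun p : ℂ × ℂ => (resample L p.1 p.2, overflow L p.1)) ⁻¹' (U ×ˢ V) ∩
      B ×ˢ (Set.univ : Set ℂ) = ((B ∩ U) ∩ (overflow L ⁻¹' V ∩ B)) ×ˢ (Set.univ : Set ℂ) := by
    ext p
    simp only [Set.mem_inter_iff, Set.mem_preimage, Set.mem_prod, Set.mem_univ, and_true, hB,
      Set.mem_ofPred_eq, resample]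
    by_cases hp : supAbs p.1 ≤ L
    · simp [hp]
    · simp [hp]
  have e2 : (fun p : ℂ × ℂ => (resample L p.1 p.2, overflow L p.1)) ⁻¹' (U ×ˢ V) \
      B ×ˢ (Set.univ : Set ℂ) = (overflow L ⁻¹' V \ B) ×ˢ U := by
    ext p
    simp only [Set.mem_sdiff, Set.mem_preimage, Set.mem_prod, Set.mem_univ, and_true, hB,
      Set.mem_ofPred_eq, resample]
    by_cases hp : supAbs p.1 ≤ L
    · simp [hp]
    · simp [hp, and_comm]
  rw [e1, e2, Measure.prod_prod, Measure.prod_prod, measure_univ, mul_one, mul_add,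
    mul_comm (ρ U) (ν (overflow L ⁻¹' V \ B))]
  congr 1
  -- The overflow vanishes on `B`, so its preimage of `V` contains `B` or misses it entirely.
  by_cases h0 : (0 : ℂ) ∈ V
  · have e3 : overflow L ⁻¹' V ∩ B = B := by
      refine Set.inter_eq_right.2 fun z hz => ?_
      have hz' : supAbs z ≤ L := hz
      simpa [overflow, hz'] using h0
    rw [e3, Set.inter_right_comm, Set.inter_self, h U hU, mul_comm]
  · have e3 : overflow L ⁻¹' V ∩ B = ∅ := by
      refine Set.eq_empty_of_forall_notMem ?_
      rintro z ⟨hz1, hz2⟩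
      have hz' : supAbs z ≤ L := hz2
      simp only [Set.mem_preimage, overflow, hz', if_true] at hz1
      exact h0 hz1
    rw [e3]
    simp

lemma map_snd_overflow {L : ℝ} {ν ρ : Measure ℂ} [IsProbabilityMeasure ν]
    [IsProbabilityMeasure ρ] :
    (ν.prod ρ).map (fun p => (p.2, overflow L p.1)) = ρ.prod (ν.map (overflow L)) := by
  have h1 : (fun p : ℂ × ℂ => (p.2, overflow L p.1)) =
      Prod.map id (overflow L) ∘ Prod.swap := rfl
  rw [h1, ← Measure.map_map (measurable_id.prodMap (measurable_overflow L)) measurable_swap,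
    Measure.prod_swap, ← Measure.map_prod_map _ _ measurable_id (measurable_overflow L),
    Measure.map_id]

section Law

variable {μ : Measure Ω} [IsProbabilityMeasure μ] {ι : Type*} [Fintype ι] {x h : Ω → ι → ℂ}
  {ν ρ : ι → Measure ℂ} [∀ i, IsProbabilityMeasure (ν i)] [∀ i, IsProbabilityMeasure (ρ i)]

lemma map_pair_eq_pi (hx : Measurable x) (hh : Measurable h) (hind : IndepFun x h μ)
    (hxl : μ.map x = Measure.pi ν) (hhl : μ.map h = Measure.pi ρ) :
    μ.map (fun ω i => (x ω i, h ω i)) = Measure.pi fun i => (ν i).prod (ρ i) := by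
  have h1 := (indepFun_iff_map_prod_eq_prod_map_map hx.aemeasurable hh.aemeasurable).1 hind
  rw [hxl, hhl, ← (measurePreserving_arrowProdEquivProdArrow ℂ ℂ ι ν ρ).map_eq] at h1
  have h2 := congrArg (Measure.map (MeasurableEquiv.arrowProdEquivProdArrow ℂ ℂ ι).symm) h1
  rw [Measure.map_map (MeasurableEquiv.measurable _) (hx.prodMk hh),
    MeasurableEquiv.map_symm_map] at h2
  exact h2

/-- A coordinatewise function of `(x, h)` whose coordinates have independent components has
independent components. -/
lemma map_comp_pair_eq_prod (hx : Measurable x) (hh : Measurable h) (hind : IndepFun x h μ)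
    (hxl : μ.map x = Measure.pi ν) (hhl : μ.map h = Measure.pi ρ)
    {φ ψ : ℂ × ℂ → ℂ} (hφ : Measurable φ) (hψ : Measurable ψ) {ξ : ι → Measure ℂ}
    [∀ i, IsProbabilityMeasure (ξ i)]
    (hlaw : ∀ i, ((ν i).prod (ρ i)).map (fun p => (φ p, ψ p)) = (ρ i).prod (ξ i)) :
    μ.map (fun ω => ((fun i => φ (x ω i, h ω i)), (fun i => ψ (x ω i, h ω i)))) =
      (Measure.pi ρ).prod (Measure.pi ξ) := by
  have hxi : ∀ i, Measurable fun ω => x ω i := fun i => (measurable_pi_apply i).comp hx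
  have hhi : ∀ i, Measurable fun ω => h ω i := fun i => (measurable_pi_apply i).comp hh
  have hpm : Measurable fun ω i => (x ω i, h ω i) :=
    measurable_pi_lambda _ fun i => (hxi i).prodMk (hhi i)
  have : ∀ i, SigmaFinite (((ν i).prod (ρ i)).map (fun p => (φ p, ψ p))) := fun i => by
    rw [hlaw]; infer_instance
  have h1 := Measure.pi_map_pi (μ := fun i => (ν i).prod (ρ i)) (f := fun _ p => (φ p, ψ p))
    fun i => (hφ.prodMk hψ).aemeasurable
  rw [← map_pair_eq_pi hx hh hind hxl hhl] at h1
  simp only [hlaw] at h1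
  have hm : Measurable fun (z : ι → ℂ × ℂ) i => (φ (z i), ψ (z i)) :=
    measurable_pi_lambda _ fun i => (hφ.prodMk hψ).comp (measurable_pi_apply i)
  rw [← (measurePreserving_arrowProdEquivProdArrow ℂ ℂ ι ρ ξ).map_eq, ← h1,
    Measure.map_map hm hpm, Measure.map_map (MeasurableEquiv.measurable _) (hm.comp hpm)]
  rfl

end Law

lemma measure_prod_le_of_forall {E Y : Type*} [MeasurableSpace E] [MeasurableSpace Y]
    {μ : Measure E} [IsProbabilityMeasure μ] {ξ : Measure Y} [IsProbabilityMeasure ξ]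
    {s : Set (E × Y)} (hs : MeasurableSet s) {c : ENNReal}
    (h : ∀ y, μ ((fun x => (x, y)) ⁻¹' s) ≤ c) : μ.prod ξ s ≤ c := by
  rw [Measure.prod_apply_symm hs]
  refine (lintegral_mono h).trans ?_
  simp

section Comparison

variable {μ : Measure Ω} [IsProbabilityMeasure μ] {ι : Type*} [Fintype ι] {x h : Ω → ι → ℂ}
  {ν ρ : ι → Measure ℂ} [∀ i, IsProbabilityMeasure (ν i)] [∀ i, IsProbabilityMeasure (ρ i)]

/-- A function `F`, convex and Lipschitz in its first argument, takes close values at the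
resampled family and at the independent copy. -/
theorem measure_abs_sub_resample_gt_le (hx : Measurable x) (hh : Measurable h)
    (hind : IndepFun x h μ) (hxl : μ.map x = Measure.pi ν) (hhl : μ.map h = Measure.pi ρ)
    {L : ℝ} (hL : 0 < L) (hρL : ∀ i, ∀ᵐ y ∂ρ i, supAbs y ≤ L)
    (hcond : ∀ i, ∀ U : Set ℂ, MeasurableSet U →
      ν i ({z | supAbs z ≤ L} ∩ U) = ν i {z | supAbs z ≤ L} * ρ i U)
    {A : ℝ} (hA : 0 < A) {F : (ι → ℂ) → (ι → ℂ) → ℝ}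
    (hFm : Measurable (Function.uncurry F)) (hF : ∀ c, ConvexOn ℝ Set.univ fun w => F w c)
    (hLip : ∀ c w w', |F w c - F w' c| ≤ √(A * ∑ i, ‖w i - w' i‖ ^ 2)) {s : ℝ} (hs : 0 < s) :
    μ {ω | 2 * s < |F (fun i => resample L (x ω i) (h ω i)) (fun i => overflow L (x ω i)) -
        F (h ω) (fun i => overflow L (x ω i))|} ≤
      ENNReal.ofReal (4 * Real.exp (-(s ^ 2 / (64 * L ^ 2 * A)))) := by
  -- Two points of `S` satisfy `‖y - y'‖² ≤ 8L²`, hence `κ‖y - y'‖² ≤ 1/8`.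
  set κ : ℝ := 1 / (64 * L ^ 2) with hκ
  have hκpos : 0 < κ := by positivity
  set S : Set ℂ := {z | supAbs z ≤ L} with hS
  have hScl : IsCompact S := by
    refine Metric.isCompact_of_isClosed_isBounded
      (isClosed_le continuous_supAbs continuous_const) ?_
    refine (Metric.isBounded_closedBall (x := (0 : ℂ)) (r := 2 * L)).subset fun z hz => ?_
    have hz' : supAbs z ≤ L := hz
    rw [mem_closedBall_zero_iff]
    have h1 := norm_sq_le_two_mul_supAbs_sq z
    have h2 := pow_le_pow_left₀ (supAbs_nonneg z) hz' 2
    nlinarith [norm_nonneg z]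
  have hκS : ∀ y ∈ S, ∀ y' ∈ S, κ * ‖y - y'‖ ^ 2 ≤ 1 / 8 := by
    intro y hy y' hy'
    have a1 := norm_sq_le_two_mul_supAbs_sq y
    have a2 := pow_le_pow_left₀ (supAbs_nonneg y) (show supAbs y ≤ L from hy) 2
    have b1 := norm_sq_le_two_mul_supAbs_sq y'
    have b2 := pow_le_pow_left₀ (supAbs_nonneg y') (show supAbs y' ≤ L from hy') 2
    have c1 : ‖y - y'‖ ^ 2 ≤ (‖y‖ + ‖y'‖) ^ 2 := by gcongr; exact norm_sub_le _ _
    rw [hκ, one_div_mul_eq_div, div_le_iff₀ (by positivity)]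
    nlinarith [sq_nonneg (‖y‖ - ‖y'‖)]
  obtain ⟨m, hm, hconc⟩ := exists_measurable_concentration hκpos hScl hκS hρL hA hFm hF hLip hs
  have hev : MeasurableSet {p : (ι → ℂ) × (ι → ℂ) | s < |F p.1 p.2 - m p.2|} :=
    measurableSet_lt measurable_const (hFm.sub (hm.comp measurable_snd)).abs
  have : ∀ i, IsProbabilityMeasure ((ν i).map (overflow L)) := fun i =>
    Measure.isProbabilityMeasure_map (measurable_overflow L).aemeasurable
  have hprod : (Measure.pi ρ).prod (Measure.pi fun i => (ν i).map (overflow L))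
      {p : (ι → ℂ) × (ι → ℂ) | s < |F p.1 p.2 - m p.2|} ≤
      ENNReal.ofReal (2 * Real.exp (-(κ * s ^ 2 / A))) :=
    measure_prod_le_of_forall hev hconc
  have hxi : ∀ i, Measurable fun ω => x ω i := fun i => (measurable_pi_apply i).comp hx
  have hhi : ∀ i, Measurable fun ω => h ω i := fun i => (measurable_pi_apply i).comp hh
  -- Used for the resampled entry and for the independent copy. Paired with the overflow, both have
  -- the same product law, so both values of `F` are close to the same centre `m`.
  have key : ∀ φ : ℂ × ℂ → ℂ, Measurable φ →
      (∀ i, ((ν i).prod (ρ i)).map (fun p => (φ p, overflow L p.1)) =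
        (ρ i).prod ((ν i).map (overflow L))) →
      μ {ω | s < |F (fun i => φ (x ω i, h ω i)) (fun i => overflow L (x ω i)) -
        m (fun i => overflow L (x ω i))|} ≤ ENNReal.ofReal (2 * Real.exp (-(κ * s ^ 2 / A))) := by
    intro φ hφ hlaw
    have h1 := map_comp_pair_eq_prod hx hh hind hxl hhl hφ
      ((measurable_overflow L).comp measurable_fst) hlaw
    have h2 : Measurable fun ω => ((fun i => φ (x ω i, h ω i)), (fun i => overflow L (x ω i))) :=
      (measurable_pi_lambda _ fun i => hφ.comp ((hxi i).prodMk (hhi i))).prodMk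
        (measurable_pi_lambda _ fun i => (measurable_overflow L).comp (hxi i))
    rw [← h1] at hprod
    exact (Measure.le_map_apply h2.aemeasurable _).trans hprod
  have k1 := key (fun p => resample L p.1 p.2) (measurable_resample L)
    fun i => map_resample_overflow (hcond i)
  have k2 := key (fun p => p.2) measurable_snd fun i => map_snd_overflow
  have hexp : κ * s ^ 2 / A = s ^ 2 / (64 * L ^ 2 * A) := by rw [hκ]; field_simp
  rw [hexp] at k1 k2
  refine (measure_mono fun ω hω => ?_).trans ((measure_union_le _ _).trans
    ((add_le_add k1 k2).trans ?_))
  · by_contra hcon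
    simp only [Set.mem_union, Set.mem_ofPred_eq, not_or, not_lt] at hcon
    have hω' : 2 * s < _ := hω
    have := abs_sub_le (F (fun i => resample L (x ω i) (h ω i)) (fun i => overflow L (x ω i)))
      (m (fun i => overflow L (x ω i))) (F (h ω) (fun i => overflow L (x ω i)))
    rw [abs_sub_comm (m _)] at this
    linarith [hcon.1, hcon.2]
  · rw [← ENNReal.ofReal_add (by positivity) (by positivity)]
    exact ENNReal.ofReal_le_ofReal (by linarith)

end Comparison

end HeavyWigner

/-! ### Comparison of the largest eigenvalues at fixed `N` -/

namespace HeavyWigner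

variable {Ω : Type*}

lemma wignerMatrix_isHermitian {X : ℕ → ℕ → Ω → ℂ} (hX : ∀ i ω, (X i i ω).im = 0) (N : ℕ) (ω : Ω) :
    (wignerMatrix X N ω).IsHermitian := by
  ext i j
  simp only [Matrix.conjTranspose_apply, wignerMatrix, Matrix.of_apply]
  rcases lt_trichotomy i j with h | rfl | h
  · simp [h.le, h.not_ge]
  · simp only [le_refl, if_true]
    exact Complex.conj_eq_iff_im.2 (hX _ _)
  · simp [h.le, h.not_ge]

lemma normalized_isHermitian {N : ℕ} {M : Matrix (Fin N) (Fin N) ℂ} (hM : M.IsHermitian) :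
    (normalized M).IsHermitian := by
  ext i j
  rw [Matrix.conjTranspose_apply]
  simp only [normalized, Matrix.of_apply, star_div₀]
  rw [hM.apply i j]
  simp

lemma largePart_apply (ε : ℝ) {N : ℕ} (M : Matrix (Fin N) (Fin N) ℂ) (i j : Fin N) :
    largePart ε M i j = largeEntry ε (√N) (M i j) := rfl

lemma largePart_isHermitian (ε : ℝ) {N : ℕ} {M : Matrix (Fin N) (Fin N) ℂ} (hM : M.IsHermitian) :
    (largePart ε M).IsHermitian := by
  ext i j
  rw [Matrix.conjTranspose_apply, largePart_apply, largePart_apply, ← hM.apply i j]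
  simp only [largeEntry, supAbs_star]
  split_ifs <;> simp

lemma topEigenvalue_normalized_wignerMatrix {X : ℕ → ℕ → Ω → ℂ} (hX : ∀ i ω, (X i i ω).im = 0)
    (N : ℕ) (ω : Ω) :
    topEigenvalue (normalized (wignerMatrix X N ω)) =
      topOf fun p : {p : Fin N × Fin N // p.1 ≤ p.2} => X p.1.1 p.1.2 ω / (√N : ℝ) := by
  rw [topOf, ← hermOf_eq (normalized_isHermitian (wignerMatrix_isHermitian hX N ω))]
  congr 2
  ext p
  simp [normalized, wignerMatrix, p.2]

lemma topEigenvalue_normalized_add_largePart {X : ℕ → ℕ → Ω → ℂ}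
    (hX : ∀ i ω, (X i i ω).im = 0) {N : ℕ} (ω : Ω) {M : Matrix (Fin N) (Fin N) ℂ}
    (hM : M.IsHermitian) (ε : ℝ) :
    topEigenvalue (normalized M + largePart ε (wignerMatrix X N ω)) =
      topOf fun p : {p : Fin N × Fin N // p.1 ≤ p.2} =>
        M p.1.1 p.1.2 / (√N : ℝ) + largeEntry ε (√N) (X p.1.1 p.1.2 ω) := by
  rw [topOf, ← hermOf_eq ((normalized_isHermitian hM).add
    (largePart_isHermitian ε (wignerMatrix_isHermitian hX N ω)))]
  congr 2
  ext p
  simp [normalized, wignerMatrix, p.2, largePart_apply]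

/-- The largest eigenvalue as a function of the entries of the truncated matrix and of those of the
matrix of large entries. -/
noncomputable def topSum {N : ℕ} (ε r : ℝ) (u c : {p : Fin N × Fin N // p.1 ≤ p.2} → ℂ) : ℝ :=
  topOf fun p => u p / (r : ℂ) + largeEntry ε r (c p)

lemma convexOn_topSum {N : ℕ} [NeZero N] (ε r : ℝ) (c : {p : Fin N × Fin N // p.1 ≤ p.2} → ℂ) :
    ConvexOn ℝ Set.univ fun u => topSum ε r u c := by
  refine ⟨convex_univ, fun w _ w' _ s q hs hq hsq => ?_⟩
  have h := convexOn_topOf.2 (Set.mem_univ fun p => w p / (r : ℂ) + largeEntry ε r (c p))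
    (Set.mem_univ fun p => w' p / (r : ℂ) + largeEntry ε r (c p)) hs hq hsq
  refine le_trans (le_of_eq ?_) h
  change topOf _ = _
  congr 1
  ext p
  simp only [Pi.add_apply, Pi.smul_apply, smul_add, Complex.real_smul]
  have : (q : ℂ) = 1 - s := by rw [eq_sub_iff_add_eq', ← Complex.ofReal_add, hsq, Complex.ofReal_one]
  rw [this]
  ring

lemma abs_topSum_sub_le {N : ℕ} [NeZero N] (ε : ℝ) {r : ℝ} (hr : 0 < r)
    (c w w' : {p : Fin N × Fin N // p.1 ≤ p.2} → ℂ) :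
    |topSum ε r w c - topSum ε r w' c| ≤ √(2 / r ^ 2 * ∑ p, ‖w p - w' p‖ ^ 2) := by
  refine (abs_topOf_sub_le _ _).trans (Real.sqrt_le_sqrt (le_of_eq ?_))
  rw [Finset.mul_sum, Finset.mul_sum]
  refine Finset.sum_congr rfl fun p _ => ?_
  rw [add_sub_add_right_eq_sub, ← sub_div, norm_div, div_pow, Complex.norm_real, Real.norm_eq_abs,
    abs_of_pos hr]
  ring

lemma measurable_topSum {N : ℕ} [NeZero N] (ε r : ℝ) :
    Measurable (Function.uncurry (topSum (N := N) ε r)) := by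
  have h1 : Measurable (topOf (N := N)) :=
    (continuous_of_abs_sub_le_sqrt (A := 2) abs_topOf_sub_le).measurable
  refine h1.comp (measurable_pi_lambda _ fun p => Measurable.add ?_ ?_)
  · exact ((measurable_pi_apply p).comp measurable_fst).div_const _
  · exact (measurable_largeEntry ε r).comp ((measurable_pi_apply p).comp measurable_snd)

variable [MeasurableSpace Ω] {μ : Measure Ω}

lemma measure_inter_eq_mul_truncatedLaw [IsProbabilityMeasure μ] {d : ℝ} {N : ℕ} {Y : Ω → ℂ} (hY : Measurable Y)
    {U : Set ℂ} (hU : MeasurableSet U) :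
    μ.map Y ({z | supAbs z ≤ Real.log N ^ d} ∩ U) =
      μ.map Y {z | supAbs z ≤ Real.log N ^ d} * truncatedLaw μ d N Y U := by
  have hB := measurableSet_supAbs_le (Real.log N ^ d)
  rw [truncatedLaw, Measure.map_apply hY hU, Measure.map_apply hY hB,
    Measure.map_apply hY (hB.inter hU), mul_comm]
  exact (cond_mul_eq_inter (hY hB) _ μ).symm

lemma ae_truncatedLaw {d : ℝ} {N : ℕ} {Y : Ω → ℂ} (hY : Measurable Y) :
    ∀ᵐ y ∂truncatedLaw μ d N Y, supAbs y ≤ Real.log N ^ d := by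
  rw [truncatedLaw, ae_map_iff hY.aemeasurable (measurableSet_supAbs_le _)]
  exact ae_cond_mem (hY (measurableSet_supAbs_le _))

lemma IsWignerFamily.identDistrib {X : ℕ → ℕ → Ω → ℂ} {α a b : ℝ} (hX : IsWignerFamily μ X α a b)
    {i j : ℕ} (hij : i ≤ j) :
    μ.map (X i j) = μ.map (X 0 (if i = j then 0 else 1)) := by
  split_ifs with h
  · subst h
    exact (hX.diag_ident i).map_eq
  · exact (hX.offDiag_ident i j (lt_of_le_of_ne hij h)).map_eq

lemma IsTruncatedCopy.law {X : ℕ → ℕ → Ω → ℂ} {d : ℝ} {N : ℕ}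
    {H : Ω → Matrix (Fin N) (Fin N) ℂ} (hH : IsTruncatedCopy μ X d N H)
    {i j : Fin N} (hij : i ≤ j) :
    μ.map (fun ω => H ω i j) = truncatedLaw μ d N (X 0 (if i = j then 0 else 1)) := by
  split_ifs with h
  · subst h
    exact hH.diag_law i
  · exact hH.offDiag_law i j (lt_of_le_of_ne hij h)

/-- The comparison for fixed `N`: the error is controlled by the sum of the error weights, up to an
event whose probability is bounded by concentration of measure. -/
theorem measure_topEigenvalue_sub_gt_le [IsProbabilityMeasure μ] {X : ℕ → ℕ → Ω → ℂ} {α a b d : ℝ}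
    (hX : IsWignerFamily μ X α a b) {N : ℕ} [NeZero N] {H : Ω → Matrix (Fin N) (Fin N) ℂ}
    (hH : IsTruncatedCopy μ X d N H) {ε t δ : ℝ} (hL : 0 < Real.log N ^ d)
    (hLε : Real.log N ^ d < ε * √N) (ht : 0 < t) (hδ1 : δ < 1) (hδ : 8 * δ ≤ (t / 2) ^ 2) :
    μ {ω | t < |topEigenvalue (normalized (wignerMatrix X N ω)) -
        topEigenvalue (normalized (H ω) + largePart ε (wignerMatrix X N ω))|} ≤
      μ {ω | δ < ∑ p : {p : Fin N × Fin N // p.1 ≤ p.2},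
        errorWeight (Real.log N ^ d) ε (√N) (supAbs (X p.1.1 p.1.2 ω))} +
      ENNReal.ofReal (4 * Real.exp (-(t ^ 2 / 2048 * (√N ^ 2 / (Real.log N ^ d) ^ 2)))) := by
  set L : ℝ := Real.log N ^ d with hLdef
  set r : ℝ := √N with hrdef
  have hr : 0 < r := Real.sqrt_pos.2 (Nat.cast_pos.2 (NeZero.pos N))
  let P := {p : Fin N × Fin N // p.1 ≤ p.2}
  let x : Ω → P → ℂ := fun ω p => X p.1.1 p.1.2 ω
  let h : Ω → P → ℂ := fun ω p => H ω p.1.1 p.1.2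
  have hle : ∀ p : P, (p.1.1 : ℕ) ≤ p.1.2 := fun p => p.2
  have hxi : ∀ p : P, Measurable (X p.1.1 p.1.2) := fun p => hX.measurable _ _ (hle p)
  have hhi : ∀ p : P, Measurable fun ω => H ω p.1.1 p.1.2 := fun p => hH.measurable _ _
  have hx : Measurable x := measurable_pi_lambda _ hxi
  have hh : Measurable h := measurable_pi_lambda _ hhi
  have hind : IndepFun x h μ := by
    have h1 := hH.indep_X.symm.comp (φ := fun w (p : P) => w p.1) (ψ := fun w (p : P) => w p.1)
      (measurable_pi_lambda _ fun p => measurable_pi_apply _)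
      (measurable_pi_lambda _ fun p => measurable_pi_apply _)
    convert h1 using 1
    · ext ω p
      simp [x, wignerMatrix, p.2]
    · rfl
  have : ∀ p : P, IsProbabilityMeasure (μ.map (X p.1.1 p.1.2)) := fun p =>
    Measure.isProbabilityMeasure_map (hxi p).aemeasurable
  have : ∀ p : P, IsProbabilityMeasure (μ.map fun ω => H ω p.1.1 p.1.2) := fun p =>
    Measure.isProbabilityMeasure_map (hhi p).aemeasurable
  have hindx : iIndepFun (fun p : P => X p.1.1 p.1.2) μ :=
    hX.indep.precomp (g := fun p : P => ⟨(p.1.1, p.1.2), hle p⟩) (fun p q hpq => by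
      simp only [Subtype.mk.injEq, Prod.mk.injEq] at hpq
      exact Subtype.ext (Prod.ext (Fin.ext hpq.1) (Fin.ext hpq.2)))
  have hxl : μ.map x = Measure.pi fun p : P => μ.map (X p.1.1 p.1.2) :=
    (iIndepFun_iff_map_fun_eq_pi_map fun p => (hxi p).aemeasurable).1 hindx
  have hhl : μ.map h = Measure.pi fun p : P => μ.map fun ω => H ω p.1.1 p.1.2 :=
    (iIndepFun_iff_map_fun_eq_pi_map fun p => (hhi p).aemeasurable).1 hH.indep
  have hY : ∀ p : P, Measurable (X 0 (if p.1.1 = p.1.2 then 0 else 1)) := fun p =>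
    hX.measurable _ _ (Nat.zero_le _)
  have hνp : ∀ p : P, μ.map (X p.1.1 p.1.2) =
      μ.map (X 0 (if p.1.1 = p.1.2 then 0 else 1)) := fun p => by
    simpa only [Fin.val_inj] using hX.identDistrib (hle p)
  have hρp : ∀ p : P, μ.map (fun ω => H ω p.1.1 p.1.2) =
      truncatedLaw μ d N (X 0 (if p.1.1 = p.1.2 then 0 else 1)) := fun p => hH.law p.2
  have hρL : ∀ p : P, ∀ᵐ y ∂μ.map (fun ω => H ω p.1.1 p.1.2), supAbs y ≤ L := fun p => by
    rw [hρp]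
    exact ae_truncatedLaw (hY p)
  -- With `s = t / 4`, this comparison uses `t / 2`; the other half is left for the deterministic
  -- perturbation.
  have hcomp := measure_abs_sub_resample_gt_le hx hh hind hxl hhl hL hρL
    (fun p U hU => by rw [hνp, hρp]; exact measure_inter_eq_mul_truncatedLaw (hY p) hU)
    (A := 2 / r ^ 2) (by positivity) (measurable_topSum ε r) (convexOn_topSum ε r)
    (abs_topSum_sub_le ε hr) (s := t / 4) (by positivity)
  have hexp : (t / 4) ^ 2 / (64 * L ^ 2 * (2 / r ^ 2)) = t ^ 2 / 2048 * (r ^ 2 / L ^ 2) := by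
    field_simp
    norm_num
  rw [hexp] at hcomp
  have hae : ∀ᵐ ω ∂μ, ∀ p : P, supAbs (h ω p) ≤ L :=
    ae_all_iff.2 fun p => ae_of_ae_map (hhi p).aemeasurable (hρL p)
  refine (measure_mono_ae ?_).trans ((measure_union_le _ _).trans (add_le_add le_rfl hcomp))
  filter_upwards [hae] with ω hω hωt
  by_contra hcon
  replace hωt : t < |_| := hωt
  have hcon' := not_or.1 hcon
  have hsum : ∑ p : P, errorWeight L ε r (supAbs (x ω p)) ≤ δ := not_lt.1 hcon'.1
  have hc : |topSum ε r (fun p => resample L (x ω p) (h ω p)) (fun p => overflow L (x ω p)) -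
      topSum ε r (h ω) (fun p => overflow L (x ω p))| ≤ 2 * (t / 4) := not_lt.1 hcon'.2
  rw [topEigenvalue_normalized_wignerMatrix hX.diag_real,
    topEigenvalue_normalized_add_largePart hX.diag_real _ (hH.hermitian ω)] at hωt
  have ov : ∀ u : P → ℂ, topSum ε r u (fun p => overflow L (x ω p)) =
      topOf fun p => u p / (r : ℂ) + largeEntry ε r (x ω p) := fun u => by
    simp only [topSum, largeEntry_overflow hL.le hLε]
  rw [ov, ov] at hc
  have hdiff := abs_topOf_sub_le (fun p : P => x ω p / (r : ℂ))
    (fun p => resample L (x ω p) (h ω p) / (r : ℂ) + largeEntry ε r (x ω p))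
  -- Each weight is at most the whole sum, hence at most `δ < 1`, so the entrywise estimate applies
  -- to every entry.
  have hbound : ∑ p : P, ‖x ω p / (r : ℂ) -
      (resample L (x ω p) (h ω p) / (r : ℂ) + largeEntry ε r (x ω p))‖ ^ 2 ≤ 4 * δ := by
    refine (Finset.sum_le_sum fun p _ => norm_sub_resample_sq_le hr hLε (hω p) ?_).trans ?_
    · exact (Finset.single_le_sum (fun q _ => errorWeight_nonneg L ε r (supAbs (x ω q)))
        (Finset.mem_univ p)).trans_lt (hsum.trans_lt hδ1)
    · rw [← Finset.mul_sum]
      linarith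
  have h2 : |topOf (fun p : P => x ω p / (r : ℂ)) -
      topOf (fun p => resample L (x ω p) (h ω p) / (r : ℂ) + largeEntry ε r (x ω p))| ≤ t / 2 := by
    refine hdiff.trans (Real.sqrt_le_iff.2 ⟨by positivity, ?_⟩)
    linarith
  have h3 := abs_sub_le (topOf (fun p : P => x ω p / (r : ℂ)))
    (topOf (fun p => resample L (x ω p) (h ω p) / (r : ℂ) + largeEntry ε r (x ω p)))
    (topOf (fun p => h ω p / (r : ℂ) + largeEntry ε r (x ω p)))
  have h4 : t < _ := hωt
  change t < |topOf (fun p : P => x ω p / (r : ℂ)) -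
    topOf (fun p => h ω p / (r : ℂ) + largeEntry ε r (x ω p))| at h4
  linarith

/-- The sum of the error weights is exponentially small. -/
theorem measure_sum_errorWeight_gt_le [IsProbabilityMeasure μ] {X : ℕ → ℕ → Ω → ℂ} {α a b : ℝ}
    (hX : IsWignerFamily μ X α a b) {N : ℕ} {K κ L ε r M : ℝ} (hK : 0 ≤ K) (hκ : 0 ≤ κ)
    (hL : 0 ≤ L) (hε : 0 < ε) (hr : 0 < r) (hεK : K * ε ^ (2 - α) + K * ε ^ α ≤ κ)
    (hLr : K * r ^ α * (L ^ 2 / r ^ 2) ≤ 1) (hM : 0 ≤ M)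
    (hM0 : ∫⁻ ω, ENNReal.ofReal (Real.exp (2 * κ * ‖X 0 0 ω‖ ^ α)) ∂μ ≤ ENNReal.ofReal M)
    (hM1 : ∫⁻ ω, ENNReal.ofReal (Real.exp (2 * κ * ‖X 0 1 ω‖ ^ α)) ∂μ ≤ ENNReal.ofReal M)
    (hN : (N : ℝ) ^ 2 * (Real.exp (1 - κ * L ^ α) * M) ≤ 1) (δ : ℝ) :
    μ {ω | δ < ∑ p : {p : Fin N × Fin N // p.1 ≤ p.2},
        errorWeight L ε r (supAbs (X p.1.1 p.1.2 ω))} ≤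
      ENNReal.ofReal (Real.exp (1 - K * r ^ α * δ)) := by
  let P := {p : Fin N × Fin N // p.1 ≤ p.2}
  have hle : ∀ p : P, (p.1.1 : ℕ) ≤ p.1.2 := fun p => p.2
  have hxi : ∀ p : P, Measurable (X p.1.1 p.1.2) := fun p => hX.measurable _ _ (hle p)
  have hindx : iIndepFun (fun p : P => X p.1.1 p.1.2) μ :=
    hX.indep.precomp (g := fun p : P => ⟨(p.1.1, p.1.2), hle p⟩) (fun p q hpq => by
      simp only [Subtype.mk.injEq, Prod.mk.injEq] at hpq
      exact Subtype.ext (Prod.ext (Fin.ext hpq.1) (Fin.ext hpq.2)))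
  have hg : Measurable fun z => errorWeight L ε r (supAbs z) :=
    (measurable_errorWeight L ε r).comp continuous_supAbs.measurable
  have hcard : (Fintype.card P : ℝ) ≤ (N : ℝ) ^ 2 := by
    have h1 : Fintype.card P ≤ Fintype.card (Fin N × Fin N) := Fintype.card_subtype_le _
    rw [Fintype.card_prod, Fintype.card_fin, ← sq] at h1
    exact_mod_cast h1
  have hq : 0 ≤ Real.exp (1 - κ * L ^ α) * M := by positivity
  refine measure_lt_sum_le hxi hindx hg (by positivity) hq
    ((mul_le_mul_of_nonneg_right hcard hq).trans hN) (fun p => ?_) δ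
  have hmg : Measurable fun z => ENNReal.ofReal
      (Real.exp (K * r ^ α * errorWeight L ε r (supAbs z))) := (hg.const_mul _).exp.ennreal_ofReal
  have hY : Measurable (X 0 (if (p.1.1 : ℕ) = p.1.2 then 0 else 1)) :=
    hX.measurable _ _ (Nat.zero_le _)
  rw [← lintegral_map (f := fun z => ENNReal.ofReal
      (Real.exp (K * r ^ α * errorWeight L ε r (supAbs z)))) hmg (hxi p),
    hX.identDistrib (hle p), lintegral_map hmg hY]
  refine lintegral_exp_errorWeight_le hX.alpha_pos hX.alpha_lt_two hK hκ hL hε hr hεK hLr hM ?_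
  split_ifs
  · exact hM0
  · exact hM1

end HeavyWigner

/-! ### Asymptotics in `N` and choice of the constants -/

namespace HeavyWigner

lemma tendsto_log_rpow_div_rpow (p : ℝ) {q : ℝ} (hq : 0 < q) :
    Tendsto (fun N : ℕ => Real.log N ^ p / (N : ℝ) ^ q) atTop (𝓝 0) :=
  (isLittleO_log_rpow_rpow_atTop p hq).tendsto_div_nhds_zero.comp tendsto_natCast_atTop_atTop

lemma eventually_log_rpow_pos (d : ℝ) : ∀ᶠ N : ℕ in atTop, 0 < Real.log N ^ d := by
  filter_upwards [eventually_gt_atTop 1] with N hN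
  exact Real.rpow_pos_of_pos (Real.log_pos (by exact_mod_cast hN)) d

lemma eventually_log_rpow_lt (d : ℝ) {ε : ℝ} (hε : 0 < ε) :
    ∀ᶠ N : ℕ in atTop, Real.log N ^ d < ε * √N := by
  filter_upwards [(tendsto_log_rpow_div_rpow d (q := 1 / 2) (by norm_num)).eventually_lt_const hε,
    eventually_gt_atTop 0] with N hN h0
  have hp : 0 < (N : ℝ) ^ (1 / 2 : ℝ) := Real.rpow_pos_of_pos (by exact_mod_cast h0) _
  rw [Real.sqrt_eq_rpow]
  exact (div_lt_iff₀ hp).1 hN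

lemma sqrt_rpow_natCast (N : ℕ) (α : ℝ) : √(N : ℝ) ^ α = (N : ℝ) ^ (α / 2) := by
  rw [Real.sqrt_eq_rpow, ← Real.rpow_mul N.cast_nonneg]
  congr 1
  ring

/-- Needed twice: to absorb the term `L²/r²` of the error weight, and to show that the concentration
exponent `N/L²` dominates the speed `N^(α/2)`. -/
lemma eventually_rpow_mul_log_rpow_le (d : ℝ) {α : ℝ} (hα : α < 2) {c : ℝ} (hc : 0 < c) :
    ∀ᶠ N : ℕ in atTop, √(N : ℝ) ^ α * ((Real.log N ^ d) ^ 2 / √(N : ℝ) ^ 2) ≤ c := by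
  filter_upwards [(tendsto_log_rpow_div_rpow (d * 2) (q := 1 - α / 2)
    (by linarith)).eventually_lt_const hc, eventually_gt_atTop 0] with N hN h0
  have h0' : (0 : ℝ) < N := by exact_mod_cast h0
  have hlog : 0 ≤ Real.log N := Real.log_natCast_nonneg N
  rw [Real.rpow_mul hlog, Real.rpow_two, Real.rpow_sub h0', Real.rpow_one] at hN
  rw [sqrt_rpow_natCast, Real.sq_sqrt h0'.le]
  refine le_trans (le_of_eq ?_) hN.le
  have := Real.rpow_pos_of_pos h0' (α / 2)
  field_simp

/-- Since `dα > 1`, `κ (log N)^(dα)` eventually exceeds `3 log N`. The resulting `N⁻³` beats the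
number of entries, with a factor `1/N` left to absorb `M`. -/
lemma eventually_sq_mul_exp_neg_log_rpow_le {d α κ M : ℝ} (hdα : 1 < d * α) (hκ : 0 < κ) :
    ∀ᶠ N : ℕ in atTop,
      (N : ℝ) ^ 2 * (Real.exp (1 - κ * (Real.log N ^ d) ^ α) * M) ≤ 1 := by
  have hlog : Tendsto (fun N : ℕ => Real.log N) atTop atTop :=
    Real.tendsto_log_atTop.comp tendsto_natCast_atTop_atTop
  have h1 := (tendsto_rpow_atTop (show 0 < d * α - 1 by linarith)).comp hlog
  filter_upwards [h1.eventually_ge_atTop (3 / κ), hlog.eventually_gt_atTop 0,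
    tendsto_natCast_atTop_atTop.eventually_ge_atTop (Real.exp 1 * M),
    eventually_gt_atTop 0] with N hN hl hNM h0
  have h0' : (0 : ℝ) < N := by exact_mod_cast h0
  have e1 : κ * (Real.log N ^ d) ^ α ≥ 3 * Real.log N := by
    rw [← Real.rpow_mul hl.le]
    have e : Real.log N ^ (d * α) = Real.log N ^ (d * α - 1) * Real.log N := by
      rw [Real.rpow_sub hl, Real.rpow_one, div_mul_cancel₀ _ hl.ne']
    simp only [Function.comp_apply] at hN
    rw [div_le_iff₀ hκ] at hN
    rw [e]
    nlinarith
  have e2 : Real.exp (1 - κ * (Real.log N ^ d) ^ α) ≤ Real.exp 1 / N ^ 3 := by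
    have e3 : (N : ℝ) ^ 3 = Real.exp (3 * Real.log N) := by
      rw [mul_comm, Real.exp_mul, Real.exp_log h0']
      norm_cast
    rw [e3, ← Real.exp_sub]
    exact Real.exp_le_exp.2 (by linarith)
  rcases le_or_gt M 0 with hM | hM
  · have : (N : ℝ) ^ 2 * (Real.exp (1 - κ * (Real.log N ^ d) ^ α) * M) ≤ 0 :=
      mul_nonpos_of_nonneg_of_nonpos (by positivity)
        (mul_nonpos_of_nonneg_of_nonpos (Real.exp_pos _).le hM)
    linarith
  · calc (N : ℝ) ^ 2 * (Real.exp (1 - κ * (Real.log N ^ d) ^ α) * M)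
        ≤ (N : ℝ) ^ 2 * (Real.exp 1 / N ^ 3 * M) := by gcongr
      _ = Real.exp 1 * M / N := by field_simp
      _ ≤ 1 := (div_le_one h0').2 hNM

lemma exp_one_sub_add_four_mul_exp_le {K u v : ℝ} (hu : 3 ≤ u) (hv : (K + 1) * u ≤ v) :
    Real.exp (1 - (K + 1) * u) + 4 * Real.exp (-v) ≤ Real.exp (-(K * u)) := by
  have h1 : Real.exp (1 - (K + 1) * u) ≤ Real.exp (-2) * Real.exp (-(K * u)) := by
    rw [← Real.exp_add]
    exact Real.exp_le_exp.2 (by linarith)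
  have h2 : Real.exp (-v) ≤ Real.exp (-3) * Real.exp (-(K * u)) := by
    rw [← Real.exp_add]
    exact Real.exp_le_exp.2 (by linarith)
  have h3 : Real.exp (-1) ≤ 1 / 2 := by
    rw [Real.exp_neg, one_div]
    exact inv_anti₀ (by norm_num) (by linarith [Real.add_one_le_exp (1 : ℝ)])
  have h4 : Real.exp (-2) = Real.exp (-1) ^ 2 := by rw [← Real.exp_nat_mul]; norm_num
  have h5 : Real.exp (-3) = Real.exp (-1) ^ 3 := by rw [← Real.exp_nat_mul]; norm_num
  have h6 : Real.exp (-2) ≤ (1 / 2) ^ 2 := by rw [h4]; gcongr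
  have h7 : Real.exp (-3) ≤ (1 / 2) ^ 3 := by rw [h5]; gcongr
  have h8 := Real.exp_pos (-(K * u))
  nlinarith

/-- The probability of a deviation decays faster than any exponential at speed `N ^ (α / 2)`, as
`ε → 0`. -/
theorem eventually_eventually_measure_le {Ω : Type*} [MeasurableSpace Ω] {μ : Measure Ω}
    [IsProbabilityMeasure μ] {X : ℕ → ℕ → Ω → ℂ} {α a b : ℝ} (hX : IsWignerFamily μ X α a b)
    {d : ℝ} (hdα : 1 < d * α) {H : (N : ℕ) → Ω → Matrix (Fin N) (Fin N) ℂ}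
    (hH : ∀ᶠ N : ℕ in atTop, IsTruncatedCopy μ X d N (H N)) {t : ℝ} (ht : 0 < t)
    {K : ℝ} (hK : 0 ≤ K) :
    ∀ᶠ ε : ℝ in 𝓝[>] 0, ∀ᶠ N : ℕ in atTop,
      μ {ω | t < |topEigenvalue (normalized (wignerMatrix X N ω)) -
          topEigenvalue (normalized (H N ω) + largePart ε (wignerMatrix X N ω))|} ≤
        ENNReal.ofReal (Real.exp (-(K * (N : ℝ) ^ (α / 2)))) := by
  have hα := hX.alpha_pos
  have hα2 := hX.alpha_lt_two
  obtain ⟨η₀, hη₀, hm0⟩ := hX.diag_tail.exists_lintegral_exp_lt_top (hX.measurable 0 0 le_rfl) hα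
    hX.b_pos
  obtain ⟨η₁, hη₁, hm1⟩ := hX.offDiag_tail.exists_lintegral_exp_lt_top
    (hX.measurable 0 1 zero_le_one) hα hX.a_pos
  set κ : ℝ := min η₀ η₁ / 2 with hκ
  have hκpos : 0 < κ := by positivity
  have hM0 := hm0 (2 * κ) (by rw [hκ, mul_div_cancel₀ _ two_ne_zero]; exact min_le_left _ _)
  have hM1 := hm1 (2 * κ) (by rw [hκ, mul_div_cancel₀ _ two_ne_zero]; exact min_le_right _ _)
  set M : ℝ := max (∫⁻ ω, ENNReal.ofReal (Real.exp (2 * κ * ‖X 0 0 ω‖ ^ α)) ∂μ).toReal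
    (∫⁻ ω, ENNReal.ofReal (Real.exp (2 * κ * ‖X 0 1 ω‖ ^ α)) ∂μ).toReal with hM
  have hMnn : 0 ≤ M := ENNReal.toReal_nonneg.trans (le_max_left _ _)
  have hM0' := (ENNReal.le_ofReal_iff_toReal_le hM0 hMnn).2 (le_max_left _ _)
  have hM1' := (ENNReal.le_ofReal_iff_toReal_le hM1 hMnn).2 (le_max_right _ _)
  set δ : ℝ := min (1 / 2) (t ^ 2 / 32) with hδ
  have hδpos : 0 < δ := by positivity
  have hδ1 : δ < 1 := (min_le_left _ _).trans_lt (by norm_num)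
  have hδt : 8 * δ ≤ (t / 2) ^ 2 := by
    have : δ ≤ t ^ 2 / 32 := min_le_right _ _
    linarith
  -- The Chernoff exponent becomes `K' r^α δ = (K + 1) r^α`; the spare unit absorbs the numerical
  -- prefactors. Since `δ` depends only on `t`, `ε` can be chosen after `K'`.
  set K' : ℝ := (K + 1) / δ with hK'
  have hK'pos : 0 < K' := by positivity
  have hεlim : Tendsto (fun ε : ℝ => K' * ε ^ (2 - α) + K' * ε ^ α) (𝓝[>] 0) (𝓝 0) := by
    have h1 : ∀ β : ℝ, 0 < β → Tendsto (fun ε : ℝ => K' * ε ^ β) (𝓝[>] 0) (𝓝 0) := fun β hβ => by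
      have h2 := (Real.continuousAt_rpow_const 0 β (Or.inr hβ.le)).tendsto.const_mul K'
      rw [Real.zero_rpow hβ.ne', mul_zero] at h2
      exact h2.mono_left nhdsWithin_le_nhds
    simpa using (h1 (2 - α) (by linarith)).add (h1 α hα)
  filter_upwards [hεlim.eventually_lt_const hκpos, self_mem_nhdsWithin] with ε hεκ hε
  have hε0 : 0 < ε := hε
  have hrt : Tendsto (fun N : ℕ => √(N : ℝ) ^ α) atTop atTop := by
    simp only [sqrt_rpow_natCast]
    exact (tendsto_rpow_atTop (by positivity)).comp tendsto_natCast_atTop_atTop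
  have hc : 0 < t ^ 2 / 2048 / (K + 1) := by positivity
  filter_upwards [hH, eventually_log_rpow_pos d, eventually_log_rpow_lt d hε0,
    eventually_rpow_mul_log_rpow_le d hα2 (inv_pos.2 hK'pos),
    eventually_rpow_mul_log_rpow_le d hα2 hc,
    eventually_sq_mul_exp_neg_log_rpow_le (M := M) hdα hκpos,
    hrt.eventually_ge_atTop 3, eventually_gt_atTop 0] with N hHN hL hLε hr1 hr2 hq hr3 hN0
  have : NeZero N := ⟨hN0.ne'⟩
  have hr : 0 < √(N : ℝ) := Real.sqrt_pos.2 (Nat.cast_pos.2 hN0)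
  have hLr : K' * √(N : ℝ) ^ α * ((Real.log N ^ d) ^ 2 / √(N : ℝ) ^ 2) ≤ 1 := by
    have := mul_le_mul_of_nonneg_left hr1 hK'pos.le
    rwa [mul_inv_cancel₀ hK'pos.ne', ← mul_assoc] at this
  refine (measure_topEigenvalue_sub_gt_le hX hHN hL hLε ht hδ1 hδt).trans ?_
  refine (add_le_add_left (measure_sum_errorWeight_gt_le hX hK'pos.le hκpos.le hL.le hε0 hr
    hεκ.le hLr hMnn hM0' hM1' hq δ) _).trans ?_
  rw [← ENNReal.ofReal_add (Real.exp_pos _).le (by positivity)]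
  refine ENNReal.ofReal_le_ofReal ?_
  have e1 : K' * √(N : ℝ) ^ α * δ = (K + 1) * √(N : ℝ) ^ α := by
    rw [hK']; field_simp
  rw [e1, ← sqrt_rpow_natCast]
  refine exp_one_sub_add_four_mul_exp_le hr3 ?_
  rw [le_div_iff₀ (by positivity)] at hr2
  have hw : 0 < (Real.log N ^ d) ^ 2 / √(N : ℝ) ^ 2 := by positivity
  have e2 : √(N : ℝ) ^ 2 / (Real.log N ^ d) ^ 2 = ((Real.log N ^ d) ^ 2 / √(N : ℝ) ^ 2)⁻¹ :=
    (inv_div _ _).symm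
  rw [e2, ← div_eq_mul_inv, le_div_iff₀ hw]
  linarith

end HeavyWigner

/-- The copies `H N` are only required to be as prescribed for large `N`, because for small `N` the
conditioning events may have probability zero. -/
theorem mainTheorem5 {Ω : Type*} [MeasurableSpace Ω] (μ : Measure Ω) [IsProbabilityMeasure μ]
    (X : ℕ → ℕ → Ω → ℂ) (α a b : ℝ) (hX : HeavyWigner.IsWignerFamily μ X α a b)
    (d : ℝ) (hd : 0 < d) (hdα : 1 < d * α)
    (H : (N : ℕ) → Ω → Matrix (Fin N) (Fin N) ℂ)
    (hH : ∀ᶠ N : ℕ in atTop, HeavyWigner.IsTruncatedCopy μ X d N (H N))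
    (t : ℝ) (ht : 0 < t) :
    Tendsto
      (fun ε : ℝ =>
        limsup
          (fun N : ℕ =>
            ((1 / (N : ℝ) ^ (α / 2) : ℝ) : EReal) *
              ENNReal.log (μ {ω | t <
                |HeavyWigner.topEigenvalue
                    (HeavyWigner.normalized (HeavyWigner.wignerMatrix X N ω))
                  - HeavyWigner.topEigenvalue
                    (HeavyWigner.normalized (H N ω)
                      + HeavyWigner.largePart ε (HeavyWigner.wignerMatrix X N ω))|}))
          atTop)
      (𝓝[>] 0) (𝓝 ⊥) := by
  rw [EReal.tendsto_nhds_bot_iff_real]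
  intro x
  -- Rate `|x| + 1` places the limsup at or below `-(|x| + 1)`, strictly under the arbitrary level
  -- `x`.
  have hK : (0 : ℝ) ≤ |x| + 1 := by positivity
  filter_upwards [HeavyWigner.eventually_eventually_measure_le hX hdα hH ht hK] with ε hε
  have hlt : ((-(|x| + 1) : ℝ) : EReal) < (x : EReal) := by
    rw [EReal.coe_lt_coe_iff]
    linarith [neg_abs_le x]
  refine lt_of_le_of_lt (limsup_le_of_le (by isBoundedDefault) ?_) hlt
  filter_upwards [hε, eventually_gt_atTop 0] with N hN hN0
  have hp : 0 < (N : ℝ) ^ (α / 2) := Real.rpow_pos_of_pos (Nat.cast_pos.2 hN0) _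
  have h1 := ENNReal.log_monotone hN
  rw [ENNReal.log_ofReal_of_pos (Real.exp_pos _), Real.log_exp] at h1
  refine (mul_le_mul_of_nonneg_left h1 (EReal.coe_nonneg.2 (by positivity))).trans (le_of_eq ?_)
  rw [← EReal.coe_mul]
  congr 1
  field_simp
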